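/- Let $U\subset\mathbb R^n$ be open, with coordinates $R=(R^1,\dots,R^n)$; all functions below are smooth on $U$. Let $ds^2=\sum_i g_{ii}(R)(dR^i)^2$, $g_{ii}\ne 0$ (of any signature), be a flat diagonal metric, $\nabla$ its Levi-Civita connection, and let $$R^i_{t^\beta}=v^i_\beta(R)\,R^i_{t^1},\qquad i=1,\dots,n,\quad \beta=1,\dots,N,\qquad t^1=x,\quad v^i_1\equiv 1,$$ be (commuting) diagonal flows which are Hamiltonian with respect to this metric: there are densities $h_\beta$ with $\nabla^i\nabla_j h_\beta=v^i_\beta\delta^i_j$. Let $a^\gamma_1$ $(\gamma=1,\dots,N)$ be conserved densities of these flows with fluxes $a^\gamma_\beta$, i.e. $\partial_i a^\gamma_\beta=v^i_\beta\,\partial_i a^\gamma_1$ (no sum over $i$), let the matrix $(a^\gamma_\beta)$ be invertible with inverse $(A^\beta_\gamma)$, and consider the generalized reciprocal transformation $d\tilde t^\gamma=a^\gamma_\beta\,dt^\beta$ (summation over repeated Greek indices), $\tilde x=\tilde t^1$. Assume $A^\nu_1v^i_\nu\neq0$ for all $i$. Assume also that the Hamiltonian flows generated by the densities $a^\gamma_1$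 are diagonal, i.e. $\nabla^i\nabla_ja_1^\gamma=0$ for $i\ne j$ (this is automatic, and need only be required at points where $v^i_\beta=v^j_\beta$ for all $\beta$); put $w^i_\gamma=\nabla^i\nabla_i a^\gamma_1$ (no sum over $i$). Let $c^\gamma_\beta$ be fluxes of $a^\gamma_1$ along the flows $R^i_{\tau^\beta}=w^i_\beta R^i_x$, i.e. $\partial_i c^\gamma_\beta=w^i_\beta\,\partial_i a^\gamma_1$, normalized by $$c^\beta_\gamma+c^\gamma_\beta=\sum_k g^{kk}\,\partial_k a^\beta_1\,\partial_k a^\gamma_1 .$$ Set $$\tilde g_{ii}=g_{ii}\,(A^\nu_1v^i_\nu)^2,\qquad \tilde v^i_\beta=\frac{A^\gamma_\beta v^i_\gamma}{A^\nu_1v^i_\nu},\qquad \tilde w^i_\gamma=\frac{w^i_\gamma-c^\beta_\gamma A^\varepsilon_\beta v^i_\varepsilon}{A^\nu_1v^i_\nu}.$$ Then the curvature tensor of the metric $d\tilde s^2=\sum_i\tilde g_{ii}(dR^i)^2$ is given by $$\tilde R^{ij}_{ij}=\sum_{\beta=1}^N\left(\tilde v^i_\beta\tilde w^j_\beta+\tilde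 v^j_\beta\tilde w^i_\beta\right)\quad(i\ne j,\ \text{no sum over } i,j),$$ and all its components $\tilde R^{ij}_{kl}$ with $\{k,l\}\neq\{i,j\}$ vanish; equivalently $\tilde R^{ij}_{kl}=\sum_{\beta}(\tilde v^i_\beta\tilde w^j_\beta+\tilde v^j_\beta\tilde w^i_\beta)(\delta^i_k\delta^j_l-\delta^i_l\delta^j_k)$ for all $i,j,k,l$ (no sum over Latin indices; the sign convention is the one in which a metric of constant curvature $c$ has $R^{ij}_{kl}=c(\delta^i_k\delta^j_l-\delta^i_l\delta^j_k)$). Moreover, with $\tilde\Gamma$ the Christoffel symbols of $d\tilde s^2$, the nonlocal operator with $2N$ tails $$\tilde J^{ij}=\tilde g^{ii}\delta^{ij}\frac{d}{d\tilde x}-\tilde g^{ii}\sum_k\tilde\Gamma^j_{ik}R^k_{\tilde x}+\sum_{\beta=1}^N\tilde v^i_\beta R^i_{\tilde x}\Big(\frac{d}{d\tilde x}\Big)^{-1}\tilde w^j_\beta R^j_{\tilde x}+\sum_{\beta=1}^N\tilde w^i_\beta R^i_{\tilde x}\Big(\frac{d}{d\tilde x}\Big)^{-1}\tilde v^j_\beta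 R^j_{\tilde x}$$ is Hamiltonian: with the skew-symmetric $\left(\frac{d}{dx}\right)^{-1}f(x)=\frac12\left(\int_{-\infty}^xf-\int_x^\infty f\right)$, the bracket $\{R^i(x),R^j(y)\}=\tilde J^{ij}\delta(x-y)$, tested against smooth compactly supported covector fields, is skew-symmetric and satisfies the Jacobi identity at every smooth field $R:\mathbb R\to U$. -/

import Mathlib

open scoped ContDiff

noncomputable section

namespace RecipTransf

/-- Partial derivative `∂_i f` at the point `R`. -/
def pd {n : ℕ} (i : Fin n) (f : (Fin n → ℝ) → ℝ) (R : Fin n → ℝ) : ℝ :=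
  fderiv ℝ f R (Pi.single i 1)

/-- Christoffel symbol `Γ^k_{ij}` of the Levi-Civita connection of the (pseudo-Riemannian) metric
with covariant components `G`. -/
def christoffel {n : ℕ} (G : (Fin n → ℝ) → Matrix (Fin n) (Fin n) ℝ) (k i j : Fin n)
    (R : Fin n → ℝ) : ℝ :=
  (1 / 2 : ℝ) * ∑ l, (G R)⁻¹ k l *
    (pd i (fun S => G S l j) R + pd j (fun S => G S l i) R - pd l (fun S => G S i j) R)

/-- Riemann tensor `R^i_{jkl} = ∂_k Γ^i_{lj} - ∂_l Γ^i_{kj} + Γ^i_{km} Γ^m_{lj} - Γ^i_{lm} Γ^m_{kj}`. -/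
def riemann {n : ℕ} (G : (Fin n → ℝ) → Matrix (Fin n) (Fin n) ℝ) (i j k l : Fin n)
    (R : Fin n → ℝ) : ℝ :=
  pd k (christoffel G i l j) R - pd l (christoffel G i k j) R
    + ∑ m, (christoffel G i k m R * christoffel G m l j R
      - christoffel G i l m R * christoffel G m k j R)

/-- Curvature tensor `R^{ij}_{kl} = g^{js} R^i_{skl}`.  The sign is such that a metric of constant
curvature `c` has `R^{ij}_{kl} = c (δ^i_k δ^j_l - δ^i_l δ^j_k)`. -/
def curvature {n : ℕ} (G : (Fin n → ℝ) → Matrix (Fin n) (Fin n) ℝ) (i j k l : Fin n)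
    (R : Fin n → ℝ) : ℝ :=
  ∑ s, (G R)⁻¹ j s * riemann G i s k l R

/-- `∇^i ∇_j h = g^{is} (∂_s ∂_j h - Γ^k_{sj} ∂_k h)`. -/
def mixedHess {n : ℕ} (G : (Fin n → ℝ) → Matrix (Fin n) (Fin n) ℝ)
    (h : (Fin n → ℝ) → ℝ) (i j : Fin n) (R : Fin n → ℝ) : ℝ :=
  ∑ s, (G R)⁻¹ i s * (pd s (pd j h) R - ∑ k, christoffel G k s j R * pd k h R)

/-- The diagonal metric `∑ g_i (dR^i)²`. -/
def diagMetric {n : ℕ} (g : Fin n → (Fin n → ℝ) → ℝ) (R : Fin n → ℝ) :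
    Matrix (Fin n) (Fin n) ℝ :=
  Matrix.diagonal fun i => g i R

/-- The inverse matrix: `invMat a ν γ = A^ν_γ`, where `a γ β = a^γ_β`. -/
def invMat {n N : ℕ} (a : Fin N → Fin N → (Fin n → ℝ) → ℝ) (ν γ : Fin N)
    (R : Fin n → ℝ) : ℝ :=
  (Matrix.of fun γ' β => a γ' β R)⁻¹ ν γ

/-- `A^γ_β v^i_γ` (sum over `γ`). -/
def speedSum {n N : ℕ} (a : Fin N → Fin N → (Fin n → ℝ) → ℝ)
    (v : Fin N → Fin n → (Fin n → ℝ) → ℝ) (β : Fin N) (i : Fin n) (R : Fin n → ℝ) : ℝ :=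
  ∑ γ, invMat a γ β R * v γ i R

/-- Transformed metric `g̃_ii = g_ii (A^ν_1 v^i_ν)²`; the index `0` of `Fin N` is the index of
`t^1 = x`. -/
def newMetric {n N : ℕ} [NeZero N] (g : Fin n → (Fin n → ℝ) → ℝ)
    (a : Fin N → Fin N → (Fin n → ℝ) → ℝ) (v : Fin N → Fin n → (Fin n → ℝ) → ℝ)
    (i : Fin n) (R : Fin n → ℝ) : ℝ :=
  g i R * speedSum a v 0 i R ^ 2

/-- Transformed speeds `ṽ^i_β = A^γ_β v^i_γ / A^ν_1 v^i_ν`. -/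
def newSpeed {n N : ℕ} [NeZero N] (a : Fin N → Fin N → (Fin n → ℝ) → ℝ)
    (v : Fin N → Fin n → (Fin n → ℝ) → ℝ) (β : Fin N) (i : Fin n) (R : Fin n → ℝ) : ℝ :=
  speedSum a v β i R / speedSum a v 0 i R

/-- Speeds `w^i_γ = ∇^i ∇_i a^γ_1` of the flows generated by the densities `a^γ_1`. -/
def extraSpeed {n N : ℕ} [NeZero N] (g : Fin n → (Fin n → ℝ) → ℝ)
    (a : Fin N → Fin N → (Fin n → ℝ) → ℝ) (γ : Fin N) (i : Fin n) (R : Fin n → ℝ) : ℝ :=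
  mixedHess (diagMetric g) (a γ 0) i i R

/-- Transformed speeds `w̃^i_γ = (w^i_γ - c^β_γ A^ε_β v^i_ε) / A^ν_1 v^i_ν`, where
`c β γ = c^β_γ`. -/
def newExtraSpeed {n N : ℕ} [NeZero N] (g : Fin n → (Fin n → ℝ) → ℝ)
    (a c : Fin N → Fin N → (Fin n → ℝ) → ℝ) (v : Fin N → Fin n → (Fin n → ℝ) → ℝ)
    (γ : Fin N) (i : Fin n) (R : Fin n → ℝ) : ℝ :=
  (extraSpeed g a γ i R - ∑ β, c β γ R * speedSum a v β i R) / speedSum a v 0 i R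

/-- The skew-symmetric antiderivative
`((d/dx)⁻¹ f)(x) = ½ (∫_{-∞}^x f - ∫_x^∞ f)`. -/
def invD (f : ℝ → ℝ) (x : ℝ) : ℝ :=
  (1 / 2 : ℝ) * ((∫ y in Set.Iic x, f y) - ∫ y in Set.Ioi x, f y)

/-- The operator
`J^{ij} = g^{ij} d/dx - g^{is} Γ^j_{sk} R^k_x + ∑_β p^i_β R^i_x (d/dx)⁻¹ q^j_β R^j_x
  + ∑_β q^i_β R^i_x (d/dx)⁻¹ p^j_β R^j_x`
at the field `R = R(x)`, applied to the covector field `ψ = ψ(x)`: the value is `(J ψ)^i (x)`. -/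
def nonlocalOp {n N : ℕ} (G : (Fin n → ℝ) → Matrix (Fin n) (Fin n) ℝ)
    (p q : Fin N → Fin n → (Fin n → ℝ) → ℝ)
    (R ψ : ℝ → Fin n → ℝ) (x : ℝ) (i : Fin n) : ℝ :=
  (∑ j, (G (R x))⁻¹ i j * deriv (fun y => ψ y j) x)
    - (∑ j, ∑ s, ∑ k, (G (R x))⁻¹ i s * christoffel G j s k (R x)
        * deriv (fun y => R y k) x * ψ x j)
    + (∑ β, p β i (R x) * deriv (fun y => R y i) x
        * invD (fun y => ∑ j, q β j (R y) * deriv (fun z => R z j) y * ψ y j) x)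
    + ∑ β, q β i (R x) * deriv (fun y => R y i) x
        * invD (fun y => ∑ j, p β j (R y) * deriv (fun z => R z j) y * ψ y j) x

/-- The Poisson bracket `{F_ξ, F_η} = ∫ ξ_i J^{ij} η_j dx`, at the field `R`, of the linear
functionals `F_ξ[R] = ∫ ξ_i R^i dx` and `F_η[R] = ∫ η_i R^i dx`; it is the distribution
`{R^i(x), R^j(y)} = J^{ij} δ(x - y)` paired with `ξ_i(x) η_j(y)`. -/
def bracket {n : ℕ} (J : (ℝ → Fin n → ℝ) → (ℝ → Fin n → ℝ) → ℝ → Fin n → ℝ)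
    (ξ η : ℝ → Fin n → ℝ) (R : ℝ → Fin n → ℝ) : ℝ :=
  ∫ x, ∑ i, ξ x i * J R η x i

/-- The derivative of `{F_ξ, F_η}` at `R` along the Hamiltonian vector field `J ζ` of `F_ζ`, that
is, the double bracket `{{F_ξ, F_η}, F_ζ}`. -/
def doubleBracket {n : ℕ} (J : (ℝ → Fin n → ℝ) → (ℝ → Fin n → ℝ) → ℝ → Fin n → ℝ)
    (ξ η ζ : ℝ → Fin n → ℝ) (R : ℝ → Fin n → ℝ) : ℝ :=
  deriv (fun ε : ℝ => bracket J ξ η (fun x => R x + ε • J R ζ x)) 0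

/-- Test covector fields: smooth with compact support. -/
def IsTest {n : ℕ} (ξ : ℝ → Fin n → ℝ) : Prop :=
  ContDiff ℝ ∞ ξ ∧ HasCompactSupport ξ

/-- `J` is a Hamiltonian operator on fields with values in `U`: the bracket is well defined,
skew-symmetric, differentiable along Hamiltonian vector fields, and satisfies the Jacobi
identity, at every smooth field `R : ℝ → U`. -/
structure IsHamiltonian {n : ℕ} (U : Set (Fin n → ℝ))
    (J : (ℝ → Fin n → ℝ) → (ℝ → Fin n → ℝ) → ℝ → Fin n → ℝ) : Prop where
  integrable : ∀ R : ℝ → Fin n → ℝ, ContDiff ℝ ∞ R → (∀ x, R x ∈ U) →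
    ∀ ξ η, IsTest ξ → IsTest η →
      MeasureTheory.Integrable (fun x => ∑ i, ξ x i * J R η x i)
  skew : ∀ R : ℝ → Fin n → ℝ, ContDiff ℝ ∞ R → (∀ x, R x ∈ U) →
    ∀ ξ η, IsTest ξ → IsTest η → bracket J ξ η R = - bracket J η ξ R
  differentiable : ∀ R : ℝ → Fin n → ℝ, ContDiff ℝ ∞ R → (∀ x, R x ∈ U) →
    ∀ ξ η ζ, IsTest ξ → IsTest η → IsTest ζ →
      DifferentiableAt ℝ (fun ε : ℝ => bracket J ξ η (fun x => R x + ε • J R ζ x)) 0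
  jacobi : ∀ R : ℝ → Fin n → ℝ, ContDiff ℝ ∞ R → (∀ x, R x ∈ U) →
    ∀ ξ η ζ, IsTest ξ → IsTest η → IsTest ζ →
      doubleBracket J ξ η ζ R + doubleBracket J η ζ ξ R + doubleBracket J ζ ξ η R = 0

end RecipTransf

end

/-
Write `s_i = A^ν_1 v^i_ν`, so that `g̃_ii = g_ii s_i²`, let `e_k = g_k dR^k`, and let `u_k` be the
covector field `∑_ε A^ν_ε v^k_ν da^ε_1`. By the conservation laws, in the frame `s_i⁻¹ ∂_i`
the Levi-Civita connection of `g̃` is that of `g` plus the bivectors `u_k ∧ e_k`. As `g` is flat,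
its curvature is `∇_k (u_l ∧ e_l) - ∇_l (u_k ∧ e_k) + [u_k ∧ e_k, u_l ∧ e_l]`. Since the Hessians of
the densities `a^ε_1` are diagonal with eigenvalues `w_ε`, everything cancels except a multiple of
`e_k ∧ e_l`, whose coefficient involves `⟨u_k, u_l⟩`. The normalization of the fluxes `c` expresses
this scalar product through `c` and turns the coefficient into the sum over the tails. The
numerators of `ṽ_β` and `w̃_β` solve the same linear system as `s`, so their quotients by `s`
satisfy the Codazzi equations of `g̃`.

For the Hamiltonian property only the Gauss and Codazzi equations matter. When the field varies,
the Gauss equation turns the curvature in the variation of the local part of the bracket into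
products of the integrands of the tails; together with the Codazzi equations this makes the
variation the sum of a total derivative and an expression without derivatives of the variation.
In the Jacobi identity the cyclic sum of these expressions vanishes pointwise.
-/

noncomputable section

namespace RecipTransf

section PartialDerivatives

variable {n : ℕ} {U : Set (Fin n → ℝ)} {f f' : (Fin n → ℝ) → ℝ} {R : Fin n → ℝ}

lemma differentiableAt_of_mem {E : Type*} [NormedAddCommGroup E] [NormedSpace ℝ E]
    {f : (Fin n → ℝ) → E} (hU : IsOpen U) (hf : ContDiffOn ℝ ∞ f U) (hR : R ∈ U) :
    DifferentiableAt ℝ f R :=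
  (hf.contDiffAt (hU.mem_nhds hR)).differentiableAt (by simp)

lemma contDiffOn_pd (hU : IsOpen U) (hf : ContDiffOn ℝ ∞ f U) (i : Fin n) :
    ContDiffOn ℝ ∞ (pd i f) U :=
  (hf.fderiv_of_isOpen hU (by simp)).clm_apply contDiffOn_const

lemma pd_congr (hU : IsOpen U) (h : ∀ S ∈ U, f S = f' S) (hR : R ∈ U) (i : Fin n) :
    pd i f R = pd i f' R := by
  have hff' : f =ᶠ[nhds R] f' := Filter.mem_of_superset (hU.mem_nhds hR) h
  rw [pd, pd, hff'.fderiv_eq]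

lemma pd_comm (hU : IsOpen U) (hf : ContDiffOn ℝ ∞ f U) (hR : R ∈ U) (i j : Fin n) :
    pd i (pd j f) R = pd j (pd i f) R := by
  have hd : DifferentiableAt ℝ (fderiv ℝ f) R :=
    ((hf.fderiv_of_isOpen hU (m := ∞) (by simp)).contDiffAt (hU.mem_nhds hR)).differentiableAt
      (by simp)
  have pd_pd (i j : Fin n) : pd i (pd j f) R
      = fderiv ℝ (fderiv ℝ f) R (Pi.single i 1) (Pi.single j 1) := by
    unfold pd
    rw [fderiv_clm_apply hd (differentiableAt_const _)]
    simp
  have hsymm : IsSymmSndFDerivAt ℝ f R :=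
    (hf.contDiffAt (hU.mem_nhds hR)).isSymmSndFDerivAt
      (by simpa using WithTop.coe_le_coe.2 (le_top : (2 : ℕ∞) ≤ ⊤))
  rw [pd_pd, pd_pd, hsymm.eq]

lemma fderiv_eq_sum_pd (f : (Fin n → ℝ) → ℝ) (R w : Fin n → ℝ) :
    fderiv ℝ f R w = ∑ k, pd k f R * w k := by
  conv_lhs => rw [pi_eq_sum_univ' w]
  simp [pd, map_sum, mul_comm]

@[simp] lemma pd_const (c : ℝ) (i : Fin n) : pd i (fun _ => c) R = 0 := by
  simp [pd]

lemma pd_add (hf : DifferentiableAt ℝ f R) (hf' : DifferentiableAt ℝ f' R) (i : Fin n) :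
    pd i (fun S => f S + f' S) R = pd i f R + pd i f' R := by
  simp [pd, fderiv_fun_add hf hf']

lemma pd_sub (hf : DifferentiableAt ℝ f R) (hf' : DifferentiableAt ℝ f' R) (i : Fin n) :
    pd i (fun S => f S - f' S) R = pd i f R - pd i f' R := by
  simp [pd, fderiv_fun_sub hf hf']

lemma pd_mul (hf : DifferentiableAt ℝ f R) (hf' : DifferentiableAt ℝ f' R) (i : Fin n) :
    pd i (fun S => f S * f' S) R = pd i f R * f' R + f R * pd i f' R := by
  simp [pd, fderiv_fun_mul hf hf']
  ring

lemma pd_inv (hf : DifferentiableAt ℝ f R) (h0 : f R ≠ 0) (i : Fin n) :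
    pd i (fun S => (f S)⁻¹) R = - pd i f R / f R ^ 2 := by
  have hinv : HasFDerivAt (fun S => (f S)⁻¹) (-(f R ^ 2)⁻¹ • fderiv ℝ f R) R :=
    (hasDerivAt_inv h0).comp_hasFDerivAt R hf.hasFDerivAt
  simp [pd, hinv.fderiv, div_eq_inv_mul]

lemma pd_div (hf : DifferentiableAt ℝ f R) (hf' : DifferentiableAt ℝ f' R) (h0 : f' R ≠ 0)
    (i : Fin n) :
    pd i (fun S => f S / f' S) R = (pd i f R * f' R - f R * pd i f' R) / f' R ^ 2 := by
  simp only [div_eq_mul_inv]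
  rw [pd_mul hf (f' := fun S => (f' S)⁻¹) (hf'.inv h0), pd_inv hf' h0]
  field_simp
  ring

lemma pd_sum {ι : Type*} (s : Finset ι) {F : ι → (Fin n → ℝ) → ℝ}
    (hF : ∀ a ∈ s, DifferentiableAt ℝ (F a) R) (i : Fin n) :
    pd i (fun S => ∑ a ∈ s, F a S) R = ∑ a ∈ s, pd i (F a) R := by
  simp [pd, fderiv_fun_sum hF]

end PartialDerivatives

section Connections

variable {n : ℕ} {U : Set (Fin n → ℝ)} {G : (Fin n → ℝ) → Matrix (Fin n) (Fin n) ℝ}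
  {R : Fin n → ℝ}

/-- The covariant derivative `∇_i x_j` of the covector field `x` for the Levi-Civita connection of
`G`. -/
def covDeriv (G : (Fin n → ℝ) → Matrix (Fin n) (Fin n) ℝ) (x : Fin n → (Fin n → ℝ) → ℝ)
    (i j : Fin n) (R : Fin n → ℝ) : ℝ :=
  pd i (x j) R - ∑ k, christoffel G k i j R * x k R

/-- The covariant Hessian `∇_i ∇_j f` for the Levi-Civita connection of `G`. -/
abbrev covHess (G : (Fin n → ℝ) → Matrix (Fin n) (Fin n) ℝ) (f : (Fin n → ℝ) → ℝ) (i j : Fin n)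
    (R : Fin n → ℝ) : ℝ :=
  covDeriv G (fun k => pd k f) i j R

/-- The curvature `∂_k C_l - ∂_l C_k + [C_k, C_l]` of the connection `∂_k + C_k` on the trivial
bundle `U × ℝⁿ`, where `C i k j` is the entry `(i, j)` of the matrix `C_k`. -/
def connCurv (C : Fin n → Fin n → Fin n → (Fin n → ℝ) → ℝ) (i j k l : Fin n) (R : Fin n → ℝ) : ℝ :=
  pd k (C i l j) R - pd l (C i k j) R + ∑ m, (C i k m R * C m l j R - C i l m R * C m k j R)

lemma riemann_eq_connCurv (i j k l : Fin n) :
    riemann G i j k l R = connCurv (christoffel G) i j k l R :=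
  rfl

lemma christoffel_comm (hG : ∀ S, (G S).IsSymm) (k i j : Fin n) (R : Fin n → ℝ) :
    christoffel G k i j R = christoffel G k j i R := by
  simp only [christoffel, funext fun S => (hG S).apply i j]
  congr! 3
  ring

lemma ricci_identity (hU : IsOpen U)
    (hΓ : ∀ k i j, DifferentiableAt ℝ (christoffel G k i j) R)
    {x : Fin n → (Fin n → ℝ) → ℝ} (hx : ∀ j, ContDiffOn ℝ ∞ (x j) U) (hR : R ∈ U)
    (i j l : Fin n) :
    (pd l (covDeriv G x i j) R - ∑ m, christoffel G m l j R * covDeriv G x i m R)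
      - (pd i (covDeriv G x l j) R - ∑ m, christoffel G m i j R * covDeriv G x l m R)
      = - ∑ p, riemann G p j l i R * x p R := by
  have dx (k : Fin n) : DifferentiableAt ℝ (x k) R := differentiableAt_of_mem hU (hx k) hR
  have dpx (i k : Fin n) : DifferentiableAt ℝ (pd i (x k)) R :=
    differentiableAt_of_mem hU (contDiffOn_pd hU (hx k) i) hR
  have dΓx (i j k : Fin n) : DifferentiableAt ℝ (fun S => christoffel G k i j S * x k S) R :=
    (hΓ k i j).fun_mul (dx k)
  have pd_covDeriv (l i j : Fin n) : pd l (covDeriv G x i j) R = pd l (pd i (x j)) R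
      - ∑ k, (pd l (christoffel G k i j) R * x k R + christoffel G k i j R * pd l (x k) R) := by
    unfold covDeriv
    rw [pd_sub (dpx i j) (DifferentiableAt.fun_sum fun k _ => dΓx i j k),
      pd_sum _ fun k _ => dΓx i j k]
    simp only [pd_mul (hΓ _ i j) (dx _)]
  have swap (l i : Fin n) : ∑ m, ∑ k, christoffel G m i j R * (christoffel G k l m R * x k R)
      = ∑ k, ∑ m, christoffel G k l m R * christoffel G m i j R * x k R := by
    rw [Finset.sum_comm]
    exact Finset.sum_congr rfl fun _ _ => Finset.sum_congr rfl fun _ _ => by ring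
  rw [pd_covDeriv, pd_covDeriv, pd_comm hU (hx j) hR l i]
  simp only [covDeriv, riemann, mul_sub, add_mul, sub_mul, Finset.mul_sum, Finset.sum_mul,
    Finset.sum_add_distrib, Finset.sum_sub_distrib, swap]
  ring

lemma connCurv_add {C B : Fin n → Fin n → Fin n → (Fin n → ℝ) → ℝ}
    (hC : ∀ i k j, DifferentiableAt ℝ (C i k j) R) (hB : ∀ i k j, DifferentiableAt ℝ (B i k j) R)
    (i j k l : Fin n) :
    connCurv (fun i k j S => C i k j S + B i k j S) i j k l R
      = connCurv C i j k l R
        + (pd k (B i l j) R + ∑ m, (C i k m R * B m l j R - B i l m R * C m k j R))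
        - (pd l (B i k j) R + ∑ m, (C i l m R * B m k j R - B i k m R * C m l j R))
        + ∑ m, (B i k m R * B m l j R - B i l m R * B m k j R) := by
  simp only [connCurv, pd_add (hC _ _ _) (hB _ _ _), add_mul, mul_add, Finset.sum_add_distrib,
    Finset.sum_sub_distrib]
  ring

lemma mul_connCurv_of_gauge (hU : IsOpen U) {s : Fin n → (Fin n → ℝ) → ℝ}
    {C C' : Fin n → Fin n → Fin n → (Fin n → ℝ) → ℝ} (hs : ∀ i, ContDiffOn ℝ ∞ (s i) U)
    (hC : ∀ i k j, DifferentiableAt ℝ (C i k j) R)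
    (hC' : ∀ i k j, DifferentiableAt ℝ (C' i k j) R)
    (hgauge : ∀ S ∈ U, ∀ i k j,
      s i S * C' i k j S = C i k j S * s j S + if i = j then pd k (s i) S else 0)
    (hR : R ∈ U) (i j k l : Fin n) :
    s i R * connCurv C' i j k l R = connCurv C i j k l R * s j R := by
  have ds (i : Fin n) := differentiableAt_of_mem hU (hs i) hR
  have dps (i k : Fin n) := differentiableAt_of_mem hU (contDiffOn_pd hU (hs i) k) hR
  have linear (k l : Fin n) : pd k (s i) R * C' i l j R + s i R * pd k (C' i l j) R
      = pd k (C i l j) R * s j R + C i l j R * pd k (s j) R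
        + if i = j then pd k (pd l (s i)) R else 0 := by
    rw [← pd_mul (ds i) (hC' i l j), pd_congr hU (fun S hS => hgauge S hS i l j) hR,
      ← pd_mul (hC i l j) (ds j), pd_add ((hC i l j).fun_mul (ds j))]
    · split_ifs <;> simp
    · split_ifs
      exacts [dps i l, differentiableAt_const _]
  have quadratic (k l : Fin n) : s i R * ∑ m, C' i k m R * C' m l j R
      = (∑ m, C i k m R * C m l j R) * s j R + C i k j R * pd l (s j) R
        + pd k (s i) R * C' i l j R := by
    have summand (m : Fin n) : s i R * (C' i k m R * C' m l j R)
        = C i k m R * C m l j R * s j R + (if m = j then C i k m R * pd l (s m) R else 0)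
          + (if i = m then pd k (s i) R * C' m l j R else 0) := by
      rw [← mul_assoc, hgauge R hR, add_mul, mul_assoc, hgauge R hR]
      split_ifs <;> ring
    simp [Finset.mul_sum, summand, Finset.sum_add_distrib, Finset.sum_mul]
  have hkl := linear k l
  rw [pd_comm hU (hs i) hR k l] at hkl
  rw [connCurv, connCurv, Finset.sum_sub_distrib, Finset.sum_sub_distrib, mul_add, mul_sub, mul_sub,
    quadratic, quadratic]
  linear_combination hkl - linear l k

end Connections

section DiagonalMetric

variable {n : ℕ} {U : Set (Fin n → ℝ)} {g : Fin n → (Fin n → ℝ) → ℝ} {R : Fin n → ℝ}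

/-- `∂_j ln H_i`, where `H_i = √|g_i|` is the Lamé coefficient of the diagonal metric `g`; the
Christoffel symbols of a diagonal metric are expressed through it. -/
def pdLogLame (g : Fin n → (Fin n → ℝ) → ℝ) (i j : Fin n) (R : Fin n → ℝ) : ℝ :=
  pd j (g i) R / (2 * g i R)

lemma pd_eq_mul_pdLogLame {i : Fin n} (h0 : g i R ≠ 0) (j : Fin n) :
    pd j (g i) R = 2 * g i R * pdLogLame g i j R := by
  unfold pdLogLame
  field_simp

lemma isSymm_diagMetric (g : Fin n → (Fin n → ℝ) → ℝ) (R : Fin n → ℝ) :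
    (diagMetric g R).IsSymm :=
  Matrix.isSymm_diagonal _

lemma diagMetric_apply (i j : Fin n) : diagMetric g R i j = if i = j then g i R else 0 :=
  Matrix.diagonal_apply _ i j

lemma inv_diagMetric_of_ne {i j : Fin n} (hij : i ≠ j) : (diagMetric g R)⁻¹ i j = 0 := by
  rw [diagMetric, Matrix.inv_diagonal, Matrix.diagonal_apply_ne _ hij]

lemma inv_diagMetric (h0 : ∀ i, g i R ≠ 0) (i j : Fin n) :
    (diagMetric g R)⁻¹ i j = if i = j then (g i R)⁻¹ else 0 := by
  have hinv : (diagMetric g R)⁻¹ = Matrix.diagonal fun i => (g i R)⁻¹ := by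
    apply Matrix.inv_eq_right_inv
    rw [diagMetric, Matrix.diagonal_mul_diagonal]
    simp [h0]
  rw [hinv, Matrix.diagonal_apply]

lemma pd_diagMetric (i j k : Fin n) :
    pd k (fun S => diagMetric g S i j) R = if i = j then pd k (g i) R else 0 := by
  rcases eq_or_ne i j with rfl | hij
  · simp [diagMetric_apply]
  · simp [diagMetric_apply, hij]

lemma christoffel_diag (h0 : ∀ i, g i R ≠ 0) (k i j : Fin n) :
    christoffel (diagMetric g) k i j R
      = (if k = j then pdLogLame g k i R else 0) + (if k = i then pdLogLame g k j R else 0)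
        - (if i = j then g i R / g k R * pdLogLame g i k R else 0) := by
  have hk := h0 k
  simp only [christoffel, inv_diagMetric h0, pd_diagMetric, ite_mul, zero_mul, Finset.sum_ite_eq,
    Finset.mem_univ, if_true, pd_eq_mul_pdLogLame (h0 _)]
  split_ifs <;> field_simp <;> ring

lemma curvature_diag (h0 : ∀ i, g i R ≠ 0) (i j k l : Fin n) :
    curvature (diagMetric g) i j k l R = (g j R)⁻¹ * riemann (diagMetric g) i j k l R := by
  simp [curvature, inv_diagMetric h0]

lemma mixedHess_diag (h0 : ∀ i, g i R ≠ 0) (f : (Fin n → ℝ) → ℝ) (i j : Fin n) :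
    mixedHess (diagMetric g) f i j R = (g i R)⁻¹ * covHess (diagMetric g) f i j R := by
  simp [mixedHess, covDeriv, inv_diagMetric h0]

lemma covHess_diag (h0 : ∀ i, g i R ≠ 0) (f : (Fin n → ℝ) → ℝ) (i j : Fin n) :
    covHess (diagMetric g) f i j R = g i R * mixedHess (diagMetric g) f i j R := by
  rw [mixedHess_diag h0, mul_inv_cancel_left₀ (h0 i)]

lemma covHess_diag_of_ne (h0 : ∀ i, g i R ≠ 0) (f : (Fin n → ℝ) → ℝ) {i j : Fin n}
    (hij : i ≠ j) :
    covHess (diagMetric g) f i j R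
      = pd i (pd j f) R - (pdLogLame g j i R * pd j f R + pdLogLame g i j R * pd i f R) := by
  simp [covDeriv, christoffel_diag h0, hij, add_mul, Finset.sum_add_distrib]

section Smoothness

variable (hU : IsOpen U) (hg : ∀ i, ContDiffOn ℝ ∞ (g i) U) (hg0 : ∀ i, ∀ R ∈ U, g i R ≠ 0)
include hU hg hg0

lemma contDiffOn_pdLogLame (i j : Fin n) : ContDiffOn ℝ ∞ (pdLogLame g i j) U :=
  (contDiffOn_pd hU (hg i) j).div (contDiffOn_const.mul (hg i))
    fun R hR => mul_ne_zero two_ne_zero (hg0 i R hR)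

lemma contDiffOn_christoffel (k i j : Fin n) :
    ContDiffOn ℝ ∞ (christoffel (diagMetric g) k i j) U := by
  have hl := contDiffOn_pdLogLame hU hg hg0
  refine ContDiffOn.congr ?_ fun S hS => christoffel_diag (fun i => hg0 i S hS) k i j
  refine ContDiffOn.sub (ContDiffOn.add ?_ ?_) ?_
  · split_ifs
    exacts [hl _ _, contDiffOn_const]
  · split_ifs
    exacts [hl _ _, contDiffOn_const]
  · split_ifs
    exacts [((hg i).div (hg k) (hg0 k)).mul (hl _ _), contDiffOn_const]

lemma contDiffOn_mixedHess {f : (Fin n → ℝ) → ℝ} (hf : ContDiffOn ℝ ∞ f U) (i j : Fin n) :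
    ContDiffOn ℝ ∞ (mixedHess (diagMetric g) f i j) U := by
  refine ContDiffOn.congr ?_ fun S hS => mixedHess_diag (fun i => hg0 i S hS) f i j
  refine ((hg i).inv (hg0 i)).mul ((contDiffOn_pd hU (contDiffOn_pd hU hf j) i).sub ?_)
  exact ContDiffOn.sum fun k _ =>
    (contDiffOn_christoffel hU hg hg0 k i j).mul (contDiffOn_pd hU hf k)

end Smoothness

/-- The Codazzi equations `∂_j w^i = (w^j - w^i) ∂_j ln H_i`, `i ≠ j`, at the point `R`: they say
that the covariant derivative of the affinor `diag(w^1, …, w^n)` is symmetric. -/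
def IsCodazzi (g w : Fin n → (Fin n → ℝ) → ℝ) (R : Fin n → ℝ) : Prop :=
  ∀ i j, i ≠ j → pd j (w i) R = pdLogLame g i j R * (w j R - w i R)

lemma isCodazzi_of_mixedHess (hU : IsOpen U) (hg : ∀ i, ContDiffOn ℝ ∞ (g i) U)
    (hg0 : ∀ i, ∀ R ∈ U, g i R ≠ 0)
    (hflat : ∀ R ∈ U, ∀ i j k l, curvature (diagMetric g) i j k l R = 0)
    {f : (Fin n → ℝ) → ℝ} (hf : ContDiffOn ℝ ∞ f U) {w : Fin n → (Fin n → ℝ) → ℝ}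
    (hw : ∀ i, ContDiffOn ℝ ∞ (w i) U)
    (hfw : ∀ R ∈ U, ∀ i j, mixedHess (diagMetric g) f i j R = if i = j then w i R else 0)
    (hR : R ∈ U) : IsCodazzi g w R := by
  intro i j hij
  have h0 (i : Fin n) : g i R ≠ 0 := hg0 i R hR
  have hhess (S : Fin n → ℝ) (hS : S ∈ U) (i j : Fin n) :
      covHess (diagMetric g) f i j S = if i = j then g i S * w i S else 0 := by
    rw [covHess_diag (fun i => hg0 i S hS), hfw S hS, mul_ite, mul_zero]
  have hriem (p : Fin n) : riemann (diagMetric g) p i j i R = 0 := by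
    simpa [curvature_diag h0, h0 i] using hflat R hR p i j i
  have hricci := ricci_identity hU
    (fun k i j => differentiableAt_of_mem hU (contDiffOn_christoffel hU hg hg0 k i j) hR)
    (contDiffOn_pd hU hf) hR i i j
  have hpd_hess : pd j (covHess (diagMetric g) f i i) R
      = 2 * g i R * pdLogLame g i j R * w i R + g i R * pd j (w i) R := by
    rw [pd_congr hU (fun S hS => (hhess S hS i i).trans (if_pos rfl)) hR,
      pd_mul (differentiableAt_of_mem hU (hg i) hR) (differentiableAt_of_mem hU (hw i) hR),
      pd_eq_mul_pdLogLame (h0 i)]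
  have hpd_hess' : pd i (covHess (diagMetric g) f j i) R = 0 := by
    rw [pd_congr hU (fun S hS => (hhess S hS j i).trans (if_neg hij.symm)) hR, pd_const]
  rw [hpd_hess, hpd_hess'] at hricci
  simp only [hhess R hR, hriem, christoffel_diag h0, mul_ite, mul_zero, zero_mul,
    Finset.sum_const_zero, Finset.sum_ite_eq, Finset.mem_univ, if_true, hij, hij.symm, if_false]
    at hricci
  refine mul_left_cancel₀ (h0 i) ?_
  field_simp [h0 j] at hricci
  linarith

lemma mixedHess_eq_zero_of_conserved (hU : IsOpen U) {w : Fin n → (Fin n → ℝ) → ℝ}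
    (hw : ∀ i, ContDiffOn ℝ ∞ (w i) U) {a b : (Fin n → ℝ) → ℝ} (ha : ContDiffOn ℝ ∞ a U)
    (hb : ContDiffOn ℝ ∞ b U) (hab : ∀ R ∈ U, ∀ i, pd i b R = w i R * pd i a R)
    (hR : R ∈ U) (h0 : ∀ i, g i R ≠ 0) (hcod : IsCodazzi g w R) {i j : Fin n} (hij : i ≠ j)
    (hne : w i R ≠ w j R) :
    mixedHess (diagMetric g) a i j R = 0 := by
  have dw (i : Fin n) := differentiableAt_of_mem hU (hw i) hR
  have da (i : Fin n) := differentiableAt_of_mem hU (contDiffOn_pd hU ha i) hR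
  have hcomm := pd_comm hU hb hR i j
  rw [pd_congr hU (fun S hS => hab S hS i) hR j, pd_congr hU (fun S hS => hab S hS j) hR i,
    pd_mul (dw i) (da i), pd_mul (dw j) (da j), hcod i j hij, hcod j i hij.symm,
    pd_comm hU ha hR j i] at hcomm
  have hprod : (w i R - w j R) * covHess (diagMetric g) a i j R = 0 := by
    rw [covHess_diag_of_ne h0 a hij]
    linarith
  rw [mixedHess_diag h0, (mul_eq_zero.1 hprod).resolve_left (sub_ne_zero.2 hne), mul_zero]

lemma IsCodazzi.pd_add_christoffel_mul {w : Fin n → (Fin n → ℝ) → ℝ} (hcod : IsCodazzi g w R)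
    (h0 : ∀ i, g i R ≠ 0) (i j k : Fin n) :
    (if i = j then pd k (w i) R else 0) + christoffel (diagMetric g) i k j R * w j R
      = (if i = k then pd j (w i) R else 0) + christoffel (diagMetric g) i k j R * w k R := by
  rw [christoffel_diag h0]
  rcases eq_or_ne i j with rfl | hij
  · rcases eq_or_ne i k with rfl | hik
    · rfl
    · simp only [hik, hik.symm, hcod i k hik, if_true, if_false]
      ring
  · rcases eq_or_ne i k with rfl | hik
    · simp only [hij, hcod i j hij, if_true, if_false]
      ring
    · rcases eq_or_ne k j with rfl | hkj
      · simp [hij]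
      · simp [hij, hik, hkj]

end DiagonalMetric

section DressedConnection

variable {n : ℕ} {U : Set (Fin n → ℝ)} {g s x y : Fin n → (Fin n → ℝ) → ℝ}
  {u : Fin n → Fin n → (Fin n → ℝ) → ℝ} {R : Fin n → ℝ}

/-- The scalar product of two covector fields in the diagonal metric `g`. -/
def diagInner (g x y : Fin n → (Fin n → ℝ) → ℝ) (R : Fin n → ℝ) : ℝ :=
  ∑ m, (g m R)⁻¹ * x m R * y m R

/-- The matrix entries of the bivector `x ∧ y` viewed as an endomorphism of the tangent space: its
first index is raised with the diagonal metric `g`. -/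
def wedgeEnd (g x y : Fin n → (Fin n → ℝ) → ℝ) (i j : Fin n) (R : Fin n → ℝ) : ℝ :=
  (g i R)⁻¹ * (x i R * y j R - y i R * x j R)

/-- The Levi-Civita connection of `g` plus the skew endomorphisms `u_k ∧ e_k`, where `e_k` is the
covector field `g_k dR^k`. For a suitable `u` it is the Levi-Civita connection of a metric
`∑ g_i s_i² (dR^i)²` in the frame `s_i⁻¹ ∂_i`. -/
def dressedConn (g : Fin n → (Fin n → ℝ) → ℝ) (u : Fin n → Fin n → (Fin n → ℝ) → ℝ)
    (i k j : Fin n) (R : Fin n → ℝ) : ℝ :=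
  christoffel (diagMetric g) i k j R + wedgeEnd g (u k) (fun j S => diagMetric g S k j) i j R

/-- The linear system whose solutions, divided by a fixed solution `s`, satisfy the Codazzi
equations of the metric `∑ g_i s_i² (dR^i)²`. -/
def IsDressedCodazzi (g : Fin n → (Fin n → ℝ) → ℝ) (u : Fin n → Fin n → (Fin n → ℝ) → ℝ)
    (y : Fin n → (Fin n → ℝ) → ℝ) (R : Fin n → ℝ) : Prop :=
  ∀ i j, i ≠ j →
    pd j (y i) R = (pdLogLame g i j R - u i j R) * y j R - pdLogLame g i j R * y i R

lemma diagInner_comm (g x y : Fin n → (Fin n → ℝ) → ℝ) (R : Fin n → ℝ) :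
    diagInner g x y R = diagInner g y x R :=
  Finset.sum_congr rfl fun _ _ => by ring

lemma diagInner_diagMetric (h0 : ∀ i, g i R ≠ 0) (x : Fin n → (Fin n → ℝ) → ℝ) (l : Fin n) :
    diagInner g x (fun j S => diagMetric g S l j) R = x l R := by
  simp only [diagInner, diagMetric_apply, mul_ite, mul_zero, Finset.sum_ite_eq,
    Finset.mem_univ, if_true]
  field_simp [h0 l]

lemma sum_wedgeEnd_mul (x y x' y' : Fin n → (Fin n → ℝ) → ℝ) (i j : Fin n) :
    ∑ m, wedgeEnd g x y i m R * wedgeEnd g x' y' m j R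
      = (g i R)⁻¹ * (x i R * (diagInner g y x' R * y' j R - diagInner g y y' R * x' j R)
        - y i R * (diagInner g x x' R * y' j R - diagInner g x y' R * x' j R)) := by
  simp only [wedgeEnd, diagInner, Finset.sum_mul, ← Finset.sum_sub_distrib, Finset.mul_sum]
  exact Finset.sum_congr rfl fun m _ => by ring

lemma christoffel_diag_metric (h0 : ∀ i, g i R ≠ 0) (i j k : Fin n) :
    christoffel (diagMetric g) i k j R * (g j R)⁻¹ + christoffel (diagMetric g) j k i R * (g i R)⁻¹
      = if i = j then 2 * (g i R)⁻¹ * pdLogLame g i k R else 0 := by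
  have hi := h0 i
  have hj := h0 j
  rw [christoffel_diag h0, christoffel_diag h0]
  rcases eq_or_ne i j with rfl | hij
  · rcases eq_or_ne i k with rfl | hik
    · simp only [if_true]
      field_simp
      ring
    · simp only [hik, hik.symm, if_true, if_false]
      ring
  · rcases eq_or_ne i k with rfl | hik
    · simp only [hij, hij.symm, if_true, if_false]
      field_simp
      ring
    · rcases eq_or_ne j k with rfl | hjk
      · simp only [hij, hij.symm, if_true, if_false]
        field_simp
        ring
      · simp [hij, hij.symm, hik, hjk, hik.symm, hjk.symm]

lemma covDeriv_diagMetric (h0 : ∀ i, g i R ≠ 0) {k l : Fin n} (hkl : k ≠ l) (j : Fin n) :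
    covDeriv (diagMetric g) (fun j S => diagMetric g S l j) k j R
      = pdLogLame g l k R * diagMetric g R l j + pdLogLame g k l R * diagMetric g R k j := by
  have hl := h0 l
  simp only [covDeriv, pd_diagMetric]
  simp only [diagMetric_apply, mul_ite, mul_zero, Finset.sum_ite_eq,
    Finset.mem_univ, if_true, pd_eq_mul_pdLogLame (h0 _), christoffel_diag h0, hkl.symm, if_false]
  split_ifs <;> field_simp <;> ring

lemma sum_christoffel_diag_mul_raise (h0 : ∀ i, g i R ≠ 0) (z : Fin n → ℝ) (i k : Fin n) :
    ∑ m, christoffel (diagMetric g) i k m R * ((g m R)⁻¹ * z m)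
      = 2 * (g i R)⁻¹ * pdLogLame g i k R * z i
        - (g i R)⁻¹ * ∑ m, christoffel (diagMetric g) m k i R * z m := by
  have summand (m : Fin n) : christoffel (diagMetric g) i k m R * ((g m R)⁻¹ * z m)
      = (if i = m then 2 * (g i R)⁻¹ * pdLogLame g i k R * z m else 0)
        - (g i R)⁻¹ * (christoffel (diagMetric g) m k i R * z m) := by
    rw [← mul_assoc, eq_sub_of_add_eq (christoffel_diag_metric h0 i m k)]
    split_ifs <;> ring
  simp [summand, Finset.sum_sub_distrib, Finset.mul_sum]

lemma pd_wedgeEnd_add_commutator (h0 : ∀ i, g i R ≠ 0)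
    (dg : ∀ i, DifferentiableAt ℝ (g i) R) (dx : ∀ i, DifferentiableAt ℝ (x i) R)
    (dy : ∀ i, DifferentiableAt ℝ (y i) R) (i j k : Fin n) :
    pd k (wedgeEnd g x y i j) R
        + ∑ m, (christoffel (diagMetric g) i k m R * wedgeEnd g x y m j R
          - wedgeEnd g x y i m R * christoffel (diagMetric g) m k j R)
      = (g i R)⁻¹ * (covDeriv (diagMetric g) x k i R * y j R
          - y i R * covDeriv (diagMetric g) x k j R
          + (x i R * covDeriv (diagMetric g) y k j R
          - covDeriv (diagMetric g) y k i R * x j R)) := by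
  have hi := h0 i
  have hpd : pd k (wedgeEnd g x y i j) R
      = -(2 * (g i R)⁻¹ * pdLogLame g i k R) * (x i R * y j R - y i R * x j R)
        + (g i R)⁻¹ * (pd k (x i) R * y j R + x i R * pd k (y j) R
          - (pd k (y i) R * x j R + y i R * pd k (x j) R)) := by
    unfold wedgeEnd
    rw [pd_mul (f := fun S => (g i S)⁻¹) ((dg i).inv hi)
        (((dx i).fun_mul (dy j)).fun_sub ((dy i).fun_mul (dx j))),
      pd_inv (dg i) hi, pd_sub ((dx i).fun_mul (dy j)) ((dy i).fun_mul (dx j)),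
      pd_mul (dx i) (dy j), pd_mul (dy i) (dx j), pd_eq_mul_pdLogLame hi]
    field_simp
  have commutator : ∑ m, (christoffel (diagMetric g) i k m R * wedgeEnd g x y m j R
        - wedgeEnd g x y i m R * christoffel (diagMetric g) m k j R)
      = (∑ m, christoffel (diagMetric g) i k m R * ((g m R)⁻¹ * x m R)) * y j R
        - (∑ m, christoffel (diagMetric g) i k m R * ((g m R)⁻¹ * y m R)) * x j R
        - (g i R)⁻¹ * (x i R * ∑ m, christoffel (diagMetric g) m k j R * y m R
          - y i R * ∑ m, christoffel (diagMetric g) m k j R * x m R) := by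
    simp only [wedgeEnd, Finset.sum_mul, Finset.mul_sum, ← Finset.sum_sub_distrib]
    exact Finset.sum_congr rfl fun m _ => by ring
  rw [hpd, commutator, sum_christoffel_diag_mul_raise h0 fun m => x m R,
    sum_christoffel_diag_mul_raise h0 fun m => y m R]
  unfold covDeriv
  ring

lemma pdLogLame_mul_sq (h0 : ∀ i, g i R ≠ 0) (hs0 : ∀ i, s i R ≠ 0)
    (dg : ∀ i, DifferentiableAt ℝ (g i) R) (ds : ∀ i, DifferentiableAt ℝ (s i) R) (i j : Fin n) :
    pdLogLame (fun i S => g i S * s i S ^ 2) i j R = pdLogLame g i j R + pd j (s i) R / s i R := by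
  have hi := h0 i
  have hsi := hs0 i
  simp only [pdLogLame, sq]
  rw [pd_mul (dg i) ((ds i).fun_mul (ds i)), pd_mul (ds i) (ds i)]
  field_simp
  ring

lemma IsDressedCodazzi.div (h0 : ∀ i, g i R ≠ 0) (hs0 : ∀ i, s i R ≠ 0)
    (dg : ∀ i, DifferentiableAt ℝ (g i) R) (ds : ∀ i, DifferentiableAt ℝ (s i) R)
    (dy : ∀ i, DifferentiableAt ℝ (y i) R) (hs : IsDressedCodazzi g u s R)
    (hy : IsDressedCodazzi g u y R) :
    IsCodazzi (fun i S => g i S * s i S ^ 2) (fun i S => y i S / s i S) R := by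
  intro i j hij
  have hsi := hs0 i
  have hsj := hs0 j
  rw [pd_div (dy i) (ds i) hsi, pdLogLame_mul_sq h0 hs0 dg ds, hs i j hij, hy i j hij]
  field_simp
  ring

-- In matrix form `s Γ̃_k = C_k s + ∂_k s`, with `s` diagonal and `C` the dressed connection.
lemma mul_christoffel_mul_sq (h0 : ∀ i, g i R ≠ 0) (hs0 : ∀ i, s i R ≠ 0)
    (dg : ∀ i, DifferentiableAt ℝ (g i) R) (ds : ∀ i, DifferentiableAt ℝ (s i) R)
    (hs : IsDressedCodazzi g u s R) (i k j : Fin n) :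
    s i R * christoffel (diagMetric fun i S => g i S * s i S ^ 2) i k j R
      = dressedConn g u i k j R * s j R + if i = j then pd k (s i) R else 0 := by
  have h0' (i : Fin n) : (fun i S => g i S * s i S ^ 2) i R ≠ 0 :=
    mul_ne_zero (h0 i) (pow_ne_zero 2 (hs0 i))
  have hi := h0 i
  have hsi := hs0 i
  have hsk := hs0 k
  rw [dressedConn, christoffel_diag h0', christoffel_diag h0]
  simp only [pdLogLame_mul_sq h0 hs0 dg ds, wedgeEnd, diagMetric_apply]
  rcases eq_or_ne i j with rfl | hij
  · rcases eq_or_ne i k with rfl | hik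
    · simp only [if_true]
      field_simp
      ring
    · simp only [hik, hik.symm, if_true, if_false]
      field_simp
      ring
  · rcases eq_or_ne i k with rfl | hik
    · simp only [hij, hs i j hij, if_true, if_false]
      field_simp
      ring
    · rcases eq_or_ne k j with rfl | hkj
      · simp only [hij, hij.symm, hs k i hij.symm, if_true, if_false]
        field_simp
        ring
      · simp [hij, hik, hkj, hik.symm]

lemma differentiableAt_diagMetric (dg : ∀ i, DifferentiableAt ℝ (g i) R) (i j : Fin n) :
    DifferentiableAt ℝ (fun S => diagMetric g S i j) R := by
  rcases eq_or_ne i j with rfl | hij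
  · simpa [diagMetric] using dg i
  · simp [diagMetric, hij]

lemma differentiableAt_wedgeEnd {i : Fin n} (h0 : g i R ≠ 0) (dg : DifferentiableAt ℝ (g i) R)
    (dx : ∀ i, DifferentiableAt ℝ (x i) R) (dy : ∀ i, DifferentiableAt ℝ (y i) R) (j : Fin n) :
    DifferentiableAt ℝ (wedgeEnd g x y i j) R :=
  (dg.inv h0).fun_mul (((dx i).fun_mul (dy j)).fun_sub ((dy i).fun_mul (dx j)))

lemma connCurv_dressedConn (h0 : ∀ i, g i R ≠ 0) (dg : ∀ i, DifferentiableAt ℝ (g i) R)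
    (dΓ : ∀ i k j, DifferentiableAt ℝ (christoffel (diagMetric g) i k j) R)
    (du : ∀ i j, DifferentiableAt ℝ (u i j) R) {z : Fin n → Fin n → ℝ}
    (huz : ∀ k l j, k ≠ l → covDeriv (diagMetric g) (u k) l j R
      = (pdLogLame g k l R - u k l R) * u l j R - pdLogLame g k l R * u k j R
        + z k l * diagMetric g R l j)
    (i j : Fin n) {k l : Fin n} (hkl : k ≠ l) :
    connCurv (dressedConn g u) i j k l R
      = riemann (diagMetric g) i j k l R
        + g j R * (z k l + z l k - diagInner g (u k) (u l) R)
        * ((if i = k then 1 else 0) * (if j = l then 1 else 0)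
          - (if i = l then 1 else 0) * (if j = k then 1 else 0)) := by
  have hi := h0 i
  have de := differentiableAt_diagMetric dg
  have dB (i k j : Fin n) := differentiableAt_wedgeEnd (h0 i) (dg i) (du k) (de k) j
  have orthogonal : diagInner g (fun j S => diagMetric g S k j)
      (fun j S => diagMetric g S l j) R = 0 := by
    rw [diagInner_diagMetric h0, diagMetric_apply, if_neg hkl]
  have orthogonal' : diagInner g (fun j S => diagMetric g S l j)
      (fun j S => diagMetric g S k j) R = 0 := by rw [diagInner_comm, orthogonal]
  unfold dressedConn
  rw [connCurv_add dΓ dB, ← riemann_eq_connCurv,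
    pd_wedgeEnd_add_commutator h0 dg (du l) (de l), pd_wedgeEnd_add_commutator h0 dg (du k) (de k),
    huz k l i hkl, huz k l j hkl, huz l k i hkl.symm, huz l k j hkl.symm,
    covDeriv_diagMetric h0 hkl, covDeriv_diagMetric h0 hkl, covDeriv_diagMetric h0 hkl.symm,
    covDeriv_diagMetric h0 hkl.symm, Finset.sum_sub_distrib, sum_wedgeEnd_mul, sum_wedgeEnd_mul,
    orthogonal, orthogonal', diagInner_comm g _ (u l), diagInner_comm g _ (u k),
    diagInner_comm g (u l) (u k)]
  simp only [diagInner_diagMetric h0]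
  have hbivector : (g i R)⁻¹ * (diagMetric g R k i * diagMetric g R l j
      - diagMetric g R l i * diagMetric g R k j)
      = g j R * ((if i = k then 1 else 0) * (if j = l then 1 else 0)
        - (if i = l then 1 else 0) * (if j = k then 1 else 0)) := by
    simp only [diagMetric_apply, eq_comm (b := i), eq_comm (b := j)]
    split_ifs <;> grind
  linear_combination (z k l + z l k - diagInner g (u k) (u l) R) * hbivector

section Curvature

variable (hU : IsOpen U) (hg : ∀ i, ContDiffOn ℝ ∞ (g i) U) (hg0 : ∀ i, ∀ R ∈ U, g i R ≠ 0)
  (hflat : ∀ R ∈ U, ∀ i j k l, curvature (diagMetric g) i j k l R = 0)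
  (hs : ∀ i, ContDiffOn ℝ ∞ (s i) U) (hs0 : ∀ i, ∀ R ∈ U, s i R ≠ 0)
  (hu : ∀ i j, ContDiffOn ℝ ∞ (u i j) U) (hsu : ∀ R ∈ U, IsDressedCodazzi g u s R)
  (hR : R ∈ U) {z : Fin n → Fin n → ℝ}
  (huz : ∀ k l j, k ≠ l → covDeriv (diagMetric g) (u k) l j R
    = (pdLogLame g k l R - u k l R) * u l j R - pdLogLame g k l R * u k j R
      + z k l * diagMetric g R l j)
include hU hg hg0 hflat hs hs0 hu hsu hR huz

lemma mul_riemann_mul_sq (i j : Fin n) {k l : Fin n} (hkl : k ≠ l) :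
    s i R * riemann (diagMetric fun i S => g i S * s i S ^ 2) i j k l R
      = g j R * (z k l + z l k - diagInner g (u k) (u l) R)
        * ((if i = k then 1 else 0) * (if j = l then 1 else 0)
          - (if i = l then 1 else 0) * (if j = k then 1 else 0)) * s j R := by
  have h0 (i : Fin n) := hg0 i R hR
  have dg {S} (hS : S ∈ U) (i : Fin n) := differentiableAt_of_mem hU (hg i) hS
  have dΓ (i k j : Fin n) := differentiableAt_of_mem hU (contDiffOn_christoffel hU hg hg0 i k j) hR
  have du (i j : Fin n) := differentiableAt_of_mem hU (hu i j) hR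
  have hriemann : riemann (diagMetric g) i j k l R = 0 := by
    simpa [curvature_diag h0, h0 j] using hflat R hR i j k l
  rw [riemann_eq_connCurv, mul_connCurv_of_gauge (C := dressedConn g u) hU hs
    (fun i k j => (dΓ i k j).fun_add (differentiableAt_wedgeEnd (h0 i) (dg hR i) (du k)
      (differentiableAt_diagMetric (dg hR) k) j))
    (fun i k j => differentiableAt_of_mem hU (contDiffOn_christoffel hU
      (fun i => (hg i).mul ((hs i).pow 2))
      (fun i S hS => mul_ne_zero (hg0 i S hS) (pow_ne_zero 2 (hs0 i S hS))) i k j) hR)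
    (fun S hS => mul_christoffel_mul_sq (fun i => hg0 i S hS) (fun i => hs0 i S hS) (dg hS)
      (fun i => differentiableAt_of_mem hU (hs i) hS) (hsu S hS)) hR i j k l,
    connCurv_dressedConn h0 (dg hR) dΓ du huz i j hkl, hriemann, zero_add]

theorem curvature_mul_sq (i j k l : Fin n) :
    curvature (diagMetric fun i S => g i S * s i S ^ 2) i j k l R
      = (z i j + z j i - diagInner g (u i) (u j) R) / (s i R * s j R)
        * ((if i = k then 1 else 0) * (if j = l then 1 else 0)
          - (if i = l then 1 else 0) * (if j = k then 1 else 0)) := by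
  have hgj := hg0 j R hR
  have hsi := hs0 i R hR
  have hsj := hs0 j R hR
  rw [curvature_diag fun i => mul_ne_zero (hg0 i R hR) (pow_ne_zero 2 (hs0 i R hR))]
  rcases eq_or_ne k l with rfl | hkl
  · simp [riemann]
  rw [← mul_right_inj' hsi, mul_left_comm,
    mul_riemann_mul_sq hU hg hg0 hflat hs hs0 hu hsu hR huz i j hkl]
  by_cases hik : i = k ∧ j = l
  · obtain ⟨rfl, rfl⟩ := hik
    field_simp
  by_cases hil : i = l ∧ j = k
  · obtain ⟨rfl, rfl⟩ := hil
    rw [diagInner_comm g (u j), add_comm (z j i)]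
    field_simp
  grind

end Curvature

end DressedConnection

section InverseMatrix

variable {n N : ℕ} {U : Set (Fin n → ℝ)} {a : Fin N → Fin N → (Fin n → ℝ) → ℝ} {R : Fin n → ℝ}

lemma contDiffOn_det (ha : ∀ γ β, ContDiffOn ℝ ∞ (a γ β) U) :
    ContDiffOn ℝ ∞ (fun R => (Matrix.of fun γ β => a γ β R).det) U := by
  simp only [Matrix.det_apply']
  exact ContDiffOn.sum fun σ _ => contDiffOn_const.mul (contDiffOn_prod fun i _ => ha _ _)

lemma contDiffOn_invMat (ha : ∀ γ β, ContDiffOn ℝ ∞ (a γ β) U)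
    (hdet : ∀ R ∈ U, IsUnit (Matrix.of fun γ β => a γ β R).det) (ν γ : Fin N) :
    ContDiffOn ℝ ∞ (invMat a ν γ) U := by
  have hadj : ContDiffOn ℝ ∞ (fun R => (Matrix.of fun γ' β => a γ' β R).adjugate ν γ) U := by
    simp only [Matrix.adjugate_apply]
    refine (contDiffOn_det (a := fun i j R =>
      if i = γ then (Pi.single ν 1 : Fin N → ℝ) j else a i j R) fun i j => ?_).congr fun R _ => ?_
    · split_ifs
      exacts [contDiffOn_const, ha i j]
    · congr 1
      ext i j
      simp [Matrix.updateRow_apply]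
  refine ((contDiffOn_det ha).inv fun R hR => (hdet R hR).ne_zero).mul hadj |>.congr fun R _ => ?_
  simp [invMat, Matrix.inv_def]

lemma sum_invMat_mul (hdet : IsUnit (Matrix.of fun γ β => a γ β R).det) (ν β : Fin N) :
    ∑ γ, invMat a ν γ R * a γ β R = if ν = β then 1 else 0 := by
  simpa [invMat, Matrix.mul_apply, Matrix.one_apply] using
    congr($(Matrix.nonsing_inv_mul _ hdet) ν β)

lemma sum_mul_invMat (hdet : IsUnit (Matrix.of fun γ β => a γ β R).det) (γ δ : Fin N) :
    ∑ β, a γ β R * invMat a β δ R = if γ = δ then 1 else 0 := by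
  simpa [invMat, Matrix.mul_apply, Matrix.one_apply] using
    congr($(Matrix.mul_nonsing_inv _ hdet) γ δ)

lemma pd_invMat (hU : IsOpen U) (ha : ∀ γ β, ContDiffOn ℝ ∞ (a γ β) U)
    (hdet : ∀ R ∈ U, IsUnit (Matrix.of fun γ β => a γ β R).det) (hR : R ∈ U)
    (ν δ : Fin N) (j : Fin n) :
    pd j (invMat a ν δ) R
      = -∑ γ, ∑ β, invMat a ν γ R * pd j (a γ β) R * invMat a β δ R := by
  have da γ β := differentiableAt_of_mem hU (ha γ β) hR
  have dA ν γ := differentiableAt_of_mem hU (contDiffOn_invMat ha hdet ν γ) hR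
  have hproduct (β : Fin N) : ∑ γ, pd j (invMat a ν γ) R * a γ β R
      = -∑ γ, invMat a ν γ R * pd j (a γ β) R := by
    have h := pd_congr hU (fun S hS => sum_invMat_mul (hdet S hS) ν β) hR j
    rw [pd_const, pd_sum _ fun γ _ => (dA ν γ).fun_mul (da γ β)] at h
    simp only [pd_mul (dA _ _) (da _ _), Finset.sum_add_distrib] at h
    exact eq_neg_of_add_eq_zero_left h
  calc pd j (invMat a ν δ) R
      = ∑ γ, pd j (invMat a ν γ) R * ∑ β, a γ β R * invMat a β δ R := by
        simp [sum_mul_invMat (hdet R hR)]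
    _ = ∑ β, (∑ γ, pd j (invMat a ν γ) R * a γ β R) * invMat a β δ R := by
        simp only [Finset.sum_mul, Finset.mul_sum, mul_assoc]
        exact Finset.sum_comm
    _ = -∑ γ, ∑ β, invMat a ν γ R * pd j (a γ β) R * invMat a β δ R := by
        simp only [hproduct, neg_mul, Finset.sum_neg_distrib, Finset.sum_mul]
        rw [Finset.sum_comm]

end InverseMatrix

/-- The data of a generalized reciprocal transformation of commuting diagonal flows which are
Hamiltonian in the flat diagonal metric `g`: speeds `v`, densities `a γ 0` with fluxes `a γ β`
along the given flows, and fluxes `c γ β` along the flows which the densities generate. -/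
structure ReciprocalSetup {n N : ℕ} [NeZero N] (U : Set (Fin n → ℝ))
    (g : Fin n → (Fin n → ℝ) → ℝ) (v : Fin N → Fin n → (Fin n → ℝ) → ℝ)
    (a c : Fin N → Fin N → (Fin n → ℝ) → ℝ) : Prop where
  isOpen : IsOpen U
  contDiffOn_metric : ∀ i, ContDiffOn ℝ ∞ (g i) U
  metric_ne_zero : ∀ i, ∀ R ∈ U, g i R ≠ 0
  flat : ∀ R ∈ U, ∀ i j k l, curvature (diagMetric g) i j k l R = 0
  contDiffOn_speed : ∀ β i, ContDiffOn ℝ ∞ (v β i) U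
  isCodazzi_speed : ∀ β, ∀ R ∈ U, IsCodazzi g (v β) R
  contDiffOn_flux : ∀ γ β, ContDiffOn ℝ ∞ (a γ β) U
  pd_flux : ∀ γ β, ∀ R ∈ U, ∀ i, pd i (a γ β) R = v β i R * pd i (a γ 0) R
  isUnit_det : ∀ R ∈ U, IsUnit (Matrix.of fun γ β => a γ β R).det
  speedSum_ne_zero : ∀ i, ∀ R ∈ U, speedSum a v 0 i R ≠ 0
  mixedHess_density : ∀ γ, ∀ R ∈ U, ∀ i j,
    mixedHess (diagMetric g) (a γ 0) i j R = if i = j then extraSpeed g a γ i R else 0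
  contDiffOn_extraFlux : ∀ γ β, ContDiffOn ℝ ∞ (c γ β) U
  pd_extraFlux : ∀ γ β, ∀ R ∈ U, ∀ i,
    pd i (c γ β) R = extraSpeed g a β i R * pd i (a γ 0) R
  extraFlux_add : ∀ γ β, ∀ R ∈ U,
    c γ β R + c β γ R = diagInner g (fun k => pd k (a β 0)) (fun k => pd k (a γ 0)) R

/-- The covector fields `∑_ε s^i_ε da^ε`, `s = speedSum`, by which a reciprocal transformation
dresses the connection. -/
def dressing {n N : ℕ} [NeZero N] (a : Fin N → Fin N → (Fin n → ℝ) → ℝ)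
    (v : Fin N → Fin n → (Fin n → ℝ) → ℝ) (i j : Fin n) (R : Fin n → ℝ) : ℝ :=
  ∑ ε, speedSum a v ε i R * pd j (a ε 0) R

/-- The numerators of the transformed speeds `newExtraSpeed`. -/
def shiftedExtraSpeed {n N : ℕ} [NeZero N] (g : Fin n → (Fin n → ℝ) → ℝ)
    (a c : Fin N → Fin N → (Fin n → ℝ) → ℝ) (v : Fin N → Fin n → (Fin n → ℝ) → ℝ)
    (γ : Fin N) (i : Fin n) (R : Fin n → ℝ) : ℝ :=
  extraSpeed g a γ i R - ∑ β, c β γ R * speedSum a v β i R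

namespace ReciprocalSetup

variable {n N : ℕ} [NeZero N] {U : Set (Fin n → ℝ)} {g : Fin n → (Fin n → ℝ) → ℝ}
  {v : Fin N → Fin n → (Fin n → ℝ) → ℝ} {a c : Fin N → Fin N → (Fin n → ℝ) → ℝ}
  {R : Fin n → ℝ}

lemma contDiffOn_speedSum (H : ReciprocalSetup U g v a c) (β : Fin N) (i : Fin n) :
    ContDiffOn ℝ ∞ (speedSum a v β i) U :=
  ContDiffOn.sum fun γ _ =>
    (contDiffOn_invMat H.contDiffOn_flux H.isUnit_det γ β).mul (H.contDiffOn_speed γ i)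

lemma contDiffOn_extraSpeed (H : ReciprocalSetup U g v a c) (γ : Fin N) (i : Fin n) :
    ContDiffOn ℝ ∞ (extraSpeed g a γ i) U :=
  contDiffOn_mixedHess H.isOpen H.contDiffOn_metric H.metric_ne_zero (H.contDiffOn_flux γ 0) i i

lemma contDiffOn_shiftedExtraSpeed (H : ReciprocalSetup U g v a c) (γ : Fin N) (i : Fin n) :
    ContDiffOn ℝ ∞ (shiftedExtraSpeed g a c v γ i) U :=
  (H.contDiffOn_extraSpeed γ i).sub <| ContDiffOn.sum fun β _ =>
    (H.contDiffOn_extraFlux β γ).mul (H.contDiffOn_speedSum β i)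

lemma contDiffOn_dressing (H : ReciprocalSetup U g v a c) (i j : Fin n) :
    ContDiffOn ℝ ∞ (dressing a v i j) U :=
  ContDiffOn.sum fun ε _ =>
    (H.contDiffOn_speedSum ε i).mul (contDiffOn_pd H.isOpen (H.contDiffOn_flux ε 0) j)

lemma contDiffOn_newMetric (H : ReciprocalSetup U g v a c) (i : Fin n) :
    ContDiffOn ℝ ∞ (newMetric g a v i) U :=
  (H.contDiffOn_metric i).mul ((H.contDiffOn_speedSum 0 i).pow 2)

lemma newMetric_ne_zero (H : ReciprocalSetup U g v a c) (i : Fin n) :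
    ∀ R ∈ U, newMetric g a v i R ≠ 0 := fun R hR =>
  mul_ne_zero (H.metric_ne_zero i R hR) (pow_ne_zero 2 (H.speedSum_ne_zero i R hR))

lemma contDiffOn_newSpeed (H : ReciprocalSetup U g v a c) (β : Fin N) (i : Fin n) :
    ContDiffOn ℝ ∞ (newSpeed a v β i) U :=
  (H.contDiffOn_speedSum β i).div (H.contDiffOn_speedSum 0 i) (H.speedSum_ne_zero i)

lemma contDiffOn_newExtraSpeed (H : ReciprocalSetup U g v a c) (β : Fin N) (i : Fin n) :
    ContDiffOn ℝ ∞ (newExtraSpeed g a c v β i) U :=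
  (H.contDiffOn_shiftedExtraSpeed β i).div (H.contDiffOn_speedSum 0 i) (H.speedSum_ne_zero i)

lemma isCodazzi_extraSpeed (H : ReciprocalSetup U g v a c) (hR : R ∈ U) (γ : Fin N) :
    IsCodazzi g (extraSpeed g a γ) R :=
  isCodazzi_of_mixedHess H.isOpen H.contDiffOn_metric H.metric_ne_zero H.flat
    (H.contDiffOn_flux γ 0) (H.contDiffOn_extraSpeed γ) (H.mixedHess_density γ) hR

lemma pd_invMat_flux (H : ReciprocalSetup U g v a c) (hR : R ∈ U) (γ β : Fin N) (j : Fin n) :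
    pd j (invMat a γ β) R
      = -((∑ ε, invMat a γ ε R * pd j (a ε 0) R) * speedSum a v β j R) := by
  rw [pd_invMat H.isOpen H.contDiffOn_flux H.isUnit_det hR, speedSum, Finset.sum_mul_sum]
  congr! 3 with ε _ δ
  rw [H.pd_flux ε δ R hR j]
  ring

lemma isDressedCodazzi_speedSum (H : ReciprocalSetup U g v a c) (hR : R ∈ U) (β : Fin N) :
    IsDressedCodazzi g (dressing a v) (speedSum a v β) R := by
  intro i j hij
  have dA γ := differentiableAt_of_mem H.isOpen
    (contDiffOn_invMat H.contDiffOn_flux H.isUnit_det γ β) hR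
  have dv γ := differentiableAt_of_mem H.isOpen (H.contDiffOn_speed γ i) hR
  have hdressing :
      dressing a v i j R = ∑ γ, (∑ ε, invMat a γ ε R * pd j (a ε 0) R) * v γ i R := by
    simp only [dressing, speedSum, Finset.sum_mul]
    rw [Finset.sum_comm]
    exact Finset.sum_congr rfl fun γ _ => Finset.sum_congr rfl fun ε _ => mul_right_comm _ _ _
  calc pd j (speedSum a v β i) R
      = ∑ γ, (-((∑ ε, invMat a γ ε R * pd j (a ε 0) R) * speedSum a v β j R) * v γ i R
          + invMat a γ β R * (pdLogLame g i j R * (v γ j R - v γ i R))) := by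
        rw [show speedSum a v β i = fun S => ∑ γ, invMat a γ β S * v γ i S from rfl,
          pd_sum _ fun γ _ => (dA γ).fun_mul (dv γ)]
        exact Finset.sum_congr rfl fun γ _ => by
          rw [pd_mul (dA γ) (dv γ), H.pd_invMat_flux hR, H.isCodazzi_speed γ R hR i j hij]
    _ = ∑ γ, (pdLogLame g i j R * (invMat a γ β R * v γ j R)
          - (∑ ε, invMat a γ ε R * pd j (a ε 0) R) * v γ i R * speedSum a v β j R
          - pdLogLame g i j R * (invMat a γ β R * v γ i R)) :=
        Finset.sum_congr rfl fun γ _ => by ring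
    _ = pdLogLame g i j R * speedSum a v β j R - dressing a v i j R * speedSum a v β j R
          - pdLogLame g i j R * speedSum a v β i R := by
        simp only [hdressing, Finset.sum_sub_distrib, ← Finset.mul_sum, ← Finset.sum_mul]
        rfl
    _ = _ := by ring

lemma isDressedCodazzi_shiftedExtraSpeed (H : ReciprocalSetup U g v a c) (hR : R ∈ U)
    (γ : Fin N) : IsDressedCodazzi g (dressing a v) (shiftedExtraSpeed g a c v γ) R := by
  intro i j hij
  have ds β := differentiableAt_of_mem H.isOpen (H.contDiffOn_speedSum β i) hR
  have dc β := differentiableAt_of_mem H.isOpen (H.contDiffOn_extraFlux β γ) hR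
  have dw := differentiableAt_of_mem H.isOpen (H.contDiffOn_extraSpeed γ i) hR
  have summand (β : Fin N) : pd j (fun S => c β γ S * speedSum a v β i S) R
      = extraSpeed g a γ j R * (speedSum a v β i R * pd j (a β 0) R)
        + (pdLogLame g i j R - dressing a v i j R) * (c β γ R * speedSum a v β j R)
        - pdLogLame g i j R * (c β γ R * speedSum a v β i R) := by
    rw [pd_mul (dc β) (ds β), H.isDressedCodazzi_speedSum hR β i j hij, H.pd_extraFlux _ _ R hR]
    ring
  have hsum : pd j (fun S => ∑ β, c β γ S * speedSum a v β i S) R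
      = extraSpeed g a γ j R * dressing a v i j R
        + (pdLogLame g i j R - dressing a v i j R) * ∑ β, c β γ R * speedSum a v β j R
        - pdLogLame g i j R * ∑ β, c β γ R * speedSum a v β i R := by
    rw [pd_sum _ fun β _ => (dc β).fun_mul (ds β)]
    simp only [summand, Finset.sum_add_distrib, Finset.sum_sub_distrib, ← Finset.mul_sum]
    rfl
  unfold shiftedExtraSpeed
  rw [pd_sub dw (DifferentiableAt.fun_sum fun β _ => (dc β).fun_mul (ds β)), hsum,
    H.isCodazzi_extraSpeed hR γ i j hij]
  ring

lemma isCodazzi_div_speedSum (H : ReciprocalSetup U g v a c) (hR : R ∈ U)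
    {y : Fin n → (Fin n → ℝ) → ℝ} (hy : ∀ i, ContDiffOn ℝ ∞ (y i) U)
    (hcod : IsDressedCodazzi g (dressing a v) y R) :
    IsCodazzi (newMetric g a v) (fun i S => y i S / speedSum a v 0 i S) R :=
  IsDressedCodazzi.div (fun i => H.metric_ne_zero i R hR) (fun i => H.speedSum_ne_zero i R hR)
    (fun i => differentiableAt_of_mem H.isOpen (H.contDiffOn_metric i) hR)
    (fun i => differentiableAt_of_mem H.isOpen (H.contDiffOn_speedSum 0 i) hR)
    (fun i => differentiableAt_of_mem H.isOpen (hy i) hR)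
    (H.isDressedCodazzi_speedSum hR 0) hcod

lemma isCodazzi_newSpeed (H : ReciprocalSetup U g v a c) (hR : R ∈ U) (β : Fin N) :
    IsCodazzi (newMetric g a v) (newSpeed a v β) R :=
  H.isCodazzi_div_speedSum hR (H.contDiffOn_speedSum β) (H.isDressedCodazzi_speedSum hR β)

lemma isCodazzi_newExtraSpeed (H : ReciprocalSetup U g v a c) (hR : R ∈ U) (β : Fin N) :
    IsCodazzi (newMetric g a v) (newExtraSpeed g a c v β) R :=
  H.isCodazzi_div_speedSum hR (H.contDiffOn_shiftedExtraSpeed β)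
    (H.isDressedCodazzi_shiftedExtraSpeed hR β)

lemma covDeriv_dressing (H : ReciprocalSetup U g v a c) (hR : R ∈ U) {k l : Fin n} (hkl : k ≠ l)
    (j : Fin n) :
    covDeriv (diagMetric g) (dressing a v k) l j R
      = (pdLogLame g k l R - dressing a v k l R) * dressing a v l j R
        - pdLogLame g k l R * dressing a v k j R
        + (∑ ε, speedSum a v ε k R * extraSpeed g a ε l R) * diagMetric g R l j := by
  have ds ε := differentiableAt_of_mem H.isOpen (H.contDiffOn_speedSum ε k) hR
  have da ε := differentiableAt_of_mem H.isOpen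
    (contDiffOn_pd H.isOpen (H.contDiffOn_flux ε 0) j) hR
  have hhess (ε : Fin N) :
      covHess (diagMetric g) (a ε 0) l j R = extraSpeed g a ε l R * diagMetric g R l j := by
    rw [covHess_diag fun i => H.metric_ne_zero i R hR, H.mixedHess_density ε R hR, diagMetric_apply]
    split_ifs <;> ring
  have leibniz : covDeriv (diagMetric g) (dressing a v k) l j R
      = ∑ ε, (pd l (speedSum a v ε k) R * pd j (a ε 0) R
        + speedSum a v ε k R * covHess (diagMetric g) (a ε 0) l j R) := by
    unfold covHess covDeriv dressing
    rw [pd_sum _ fun ε _ => (ds ε).fun_mul (da ε)]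
    simp only [pd_mul (ds _) (da _), mul_sub, Finset.sum_add_distrib, Finset.sum_sub_distrib,
      Finset.mul_sum, add_sub_assoc]
    rw [Finset.sum_comm]
    simp only [mul_left_comm]
  rw [leibniz]
  calc ∑ ε, (pd l (speedSum a v ε k) R * pd j (a ε 0) R
        + speedSum a v ε k R * covHess (diagMetric g) (a ε 0) l j R)
      = ∑ ε, ((pdLogLame g k l R - dressing a v k l R) * (speedSum a v ε l R * pd j (a ε 0) R)
        - pdLogLame g k l R * (speedSum a v ε k R * pd j (a ε 0) R)
        + speedSum a v ε k R * extraSpeed g a ε l R * diagMetric g R l j) :=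
        Finset.sum_congr rfl fun ε _ => by
          rw [hhess, H.isDressedCodazzi_speedSum hR ε k l hkl]
          ring
    _ = _ := by
        simp only [Finset.sum_add_distrib, Finset.sum_sub_distrib, ← Finset.mul_sum,
          ← Finset.sum_mul]
        rfl

lemma diagInner_dressing (H : ReciprocalSetup U g v a c) (hR : R ∈ U) (k l : Fin n) :
    diagInner g (dressing a v k) (dressing a v l) R
      = ∑ ε, ∑ δ, speedSum a v ε k R * speedSum a v δ l R * (c ε δ R + c δ ε R) := by
  simp only [H.extraFlux_add _ _ R hR, diagInner, dressing, Finset.mul_sum, Finset.sum_mul]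
  rw [Finset.sum_comm]
  simp only [Finset.sum_comm (s := (Finset.univ : Finset (Fin n)))]
  rw [Finset.sum_comm]
  exact Finset.sum_congr rfl fun ε _ => Finset.sum_congr rfl fun δ _ =>
    Finset.sum_congr rfl fun m _ => by ring

lemma sum_speedSum_mul_shiftedExtraSpeed (H : ReciprocalSetup U g v a c) (hR : R ∈ U)
    (k l : Fin n) :
    ∑ ε, speedSum a v ε k R * extraSpeed g a ε l R + ∑ ε, speedSum a v ε l R * extraSpeed g a ε k R
        - diagInner g (dressing a v k) (dressing a v l) R
      = ∑ ε, (speedSum a v ε k R * shiftedExtraSpeed g a c v ε l R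
        + speedSum a v ε l R * shiftedExtraSpeed g a c v ε k R) := by
  have hk : ∑ ε, ∑ δ, speedSum a v ε k R * speedSum a v δ l R * c ε δ R
      = ∑ ε, speedSum a v ε l R * ∑ β, c β ε R * speedSum a v β k R := by
    simp only [Finset.mul_sum]
    rw [Finset.sum_comm]
    exact Finset.sum_congr rfl fun ε _ => Finset.sum_congr rfl fun δ _ => by ring
  have hl : ∑ ε, ∑ δ, speedSum a v ε k R * speedSum a v δ l R * c δ ε R
      = ∑ ε, speedSum a v ε k R * ∑ β, c β ε R * speedSum a v β l R := by
    simp only [Finset.mul_sum]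
    exact Finset.sum_congr rfl fun ε _ => Finset.sum_congr rfl fun δ _ => by ring
  simp only [H.diagInner_dressing hR, mul_add, Finset.sum_add_distrib, hk, hl, shiftedExtraSpeed,
    mul_sub, Finset.sum_sub_distrib]
  ring

theorem curvature_newMetric (H : ReciprocalSetup U g v a c) (hR : R ∈ U) (i j k l : Fin n) :
    curvature (diagMetric (newMetric g a v)) i j k l R
      = (∑ β, (newSpeed a v β i R * newExtraSpeed g a c v β j R
          + newSpeed a v β j R * newExtraSpeed g a c v β i R))
        * ((if i = k then 1 else 0) * (if j = l then 1 else 0)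
          - (if i = l then 1 else 0) * (if j = k then 1 else 0)) := by
  have hquotient : ∑ β, (newSpeed a v β i R * newExtraSpeed g a c v β j R
        + newSpeed a v β j R * newExtraSpeed g a c v β i R)
      = (∑ β, (speedSum a v β i R * shiftedExtraSpeed g a c v β j R
        + speedSum a v β j R * shiftedExtraSpeed g a c v β i R))
          / (speedSum a v 0 i R * speedSum a v 0 j R) := by
    rw [Finset.sum_div]
    refine Finset.sum_congr rfl fun β _ => ?_
    simp only [newSpeed, newExtraSpeed, ← shiftedExtraSpeed.eq_1]
    ring
  rw [hquotient, ← H.sum_speedSum_mul_shiftedExtraSpeed hR]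
  exact curvature_mul_sq H.isOpen H.contDiffOn_metric H.metric_ne_zero H.flat
    (H.contDiffOn_speedSum 0) H.speedSum_ne_zero H.contDiffOn_dressing
    (fun S hS => H.isDressedCodazzi_speedSum hS 0) hR
    (z := fun k l => ∑ ε, speedSum a v ε k R * extraSpeed g a ε l R)
    (fun k l j hkl => H.covDeriv_dressing hR hkl j) i j k l

end ReciprocalSetup

open MeasureTheory Set

section SkewAntiderivative

lemma eventually_eq_zero_of_notMem_Ioo {E : Type*} [Zero E] {f : ℝ → E}
    (hf : HasCompactSupport f) : ∀ᶠ r in Filter.atTop, ∀ x ∉ Ioo (-r) r, f x = 0 := by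
  obtain ⟨s, -, hs⟩ := hf.exists_pos_le_norm
  filter_upwards [Filter.eventually_ge_atTop s] with r hr x hx
  refine hs x (hr.trans ?_)
  rwa [Real.norm_eq_abs, ← not_lt, abs_lt]

lemma hasCompactSupport_of_eq_zero {E F : Type*} [Zero E] [Zero F] {f : ℝ → E} {k : ℝ → F}
    (hf : HasCompactSupport f) (h : ∀ x, f x = 0 → k x = 0) : HasCompactSupport k :=
  hf.mono fun x hx hx' => hx (h x hx')

variable {f k : ℝ → ℝ} {a b : ℝ}

lemma integral_eq_intervalIntegral_of_eq_zero (hf : ∀ x ∉ Ioo a b, f x = 0) :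
    ∫ x, f x = ∫ x in a..b, f x :=
  (intervalIntegral.integral_eq_integral_of_support_subset fun x hx =>
    Ioo_subset_Ioc_self (not_imp_comm.1 (hf x) hx)).symm

lemma integrable_of_eq_zero (hc : ContinuousOn f (Icc a b)) (hf : ∀ x ∉ Ioo a b, f x = 0) :
    Integrable f :=
  (hc.integrableOn_Icc (μ := volume)).integrable_of_forall_notMem_eq_zero fun x hx =>
    hf x fun h => hx (Ioo_subset_Icc_self h)

lemma invD_eq_intervalIntegral (hc : ContinuousOn f (Icc a b)) (hf : ∀ x ∉ Ioo a b, f x = 0)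
    (x : ℝ) : invD f x = (∫ y in a..x, f y) - (1 / 2 : ℝ) * ∫ y in a..b, f y := by
  have hi := integrable_of_eq_zero hc hf
  have hleft : ∫ y in Iic a, f y = 0 :=
    setIntegral_eq_zero_of_forall_eq_zero fun y hy => hf y fun h => hy.not_gt h.1
  have hIic : ∫ y in Iic x, f y = ∫ y in a..x, f y := by
    rw [← intervalIntegral.integral_Iic_sub_Iic hi.integrableOn hi.integrableOn, hleft, sub_zero]
  have htotal : (∫ y in Iic x, f y) + ∫ y in Ioi x, f y = ∫ y in a..b, f y := by
    rw [intervalIntegral.integral_Iic_add_Ioi hi.integrableOn hi.integrableOn,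
      integral_eq_intervalIntegral_of_eq_zero hf]
  unfold invD
  linarith

lemma hasDerivAt_invD (hf : Continuous f) (hfs : HasCompactSupport f) (x : ℝ) :
    HasDerivAt (invD f) (f x) x := by
  obtain ⟨r, hr⟩ := (eventually_eq_zero_of_notMem_Ioo hfs).exists
  rw [funext (invD_eq_intervalIntegral hf.continuousOn hr)]
  exact (intervalIntegral.integral_hasDerivAt_right (hf.intervalIntegrable _ _)
    (hf.stronglyMeasurableAtFilter _ _) hf.continuousAt).sub_const _

lemma contDiff_invD (hf : ContDiff ℝ ∞ f) (hfs : HasCompactSupport f) :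
    ContDiff ℝ ∞ (invD f) := by
  have h := hasDerivAt_invD hf.continuous hfs
  rw [contDiff_infty_iff_deriv, funext fun x => (h x).deriv]
  exact ⟨fun x => (h x).differentiableAt, hf⟩

lemma integral_deriv_eq_zero_of_hasCompactSupport {f' : ℝ → ℝ} (hf : ∀ x, HasDerivAt f (f' x) x)
    (hc : Continuous f') (hfs : HasCompactSupport f) : ∫ x, f' x = 0 := by
  have hfs' : HasCompactSupport f' := by
    rw [funext fun x => (hf x).deriv.symm]
    exact hfs.deriv
  have hcf : Continuous f := continuous_iff_continuousAt.2 fun x => (hf x).continuousAt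
  exact integral_eq_zero_of_hasDerivAt_of_integrable hf (hc.integrable_of_hasCompactSupport hfs')
    (hcf.integrable_of_hasCompactSupport hfs)

lemma integrable_mul_invD (hf : ContDiff ℝ ∞ f) (hfs : HasCompactSupport f)
    (hk : ContDiff ℝ ∞ k) (hks : HasCompactSupport k) : Integrable fun x => f x * invD k x :=
  (hf.continuous.mul (contDiff_invD hk hks).continuous).integrable_of_hasCompactSupport
    hfs.mul_right

lemma integral_mul_invD (hf : ContDiff ℝ ∞ f) (hfs : HasCompactSupport f) (hk : ContDiff ℝ ∞ k)
    (hks : HasCompactSupport k) : ∫ x, f x * invD k x = -∫ x, k x * invD f x := by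
  obtain ⟨r, hr, hr'⟩ :=
    ((eventually_eq_zero_of_notMem_Ioo hfs).and (eventually_eq_zero_of_notMem_Ioo hks)).exists
  have hderiv (x : ℝ) :
      HasDerivAt (fun x => invD f x * invD k x) (f x * invD k x + k x * invD f x) x :=
    ((hasDerivAt_invD hf.continuous hfs x).mul
      (hasDerivAt_invD hk.continuous hks x)).congr_deriv (by ring)
  have hcont : Continuous fun x => f x * invD k x + k x * invD f x :=
    (hf.continuous.mul (contDiff_invD hk hks).continuous).add
      (hk.continuous.mul (contDiff_invD hf hfs).continuous)
  rw [eq_neg_iff_add_eq_zero, ← integral_add (integrable_mul_invD hf hfs hk hks)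
      (integrable_mul_invD hk hks hf hfs),
    integral_eq_intervalIntegral_of_eq_zero (a := -r) (b := r) fun x hx => by
      rw [hr x hx, hr' x hx, zero_mul, zero_mul, add_zero],
    intervalIntegral.integral_eq_sub_of_hasDerivAt (fun x _ => hderiv x)
      (hcont.intervalIntegrable _ _)]
  -- `invD f (± r) = ± (∫ f) / 2`, so the product takes the same value at both ends.
  simp only [invD_eq_intervalIntegral hf.continuous.continuousOn hr,
    invD_eq_intervalIntegral hk.continuous.continuousOn hr', intervalIntegral.integral_same]
  ring

end SkewAntiderivative

section Families

lemma continuousOn_intervalIntegral {c d a b : ℝ} {f : ℝ → ℝ → ℝ} (hcd : c ≤ d) (hab : a ≤ b)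
    (hf : ContinuousOn (fun p : ℝ × ℝ => f p.1 p.2) (Icc c d ×ˢ Icc a b)) :
    ContinuousOn (fun p : ℝ × ℝ => ∫ y in a..p.2, f p.1 y) (Icc c d ×ˢ Icc a b) := by
  have hc : Continuous fun p : ℝ × ℝ => f (projIcc c d hcd p.1) (projIcc a b hab p.2) :=
    hf.comp_continuous (f := fun p : ℝ × ℝ =>
      (((projIcc c d hcd p.1 : ℝ), (projIcc a b hab p.2 : ℝ)) : ℝ × ℝ))
      (by fun_prop) fun p => ⟨Subtype.coe_prop _, Subtype.coe_prop _⟩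
  have hint : Continuous fun p : ℝ × ℝ =>
      ∫ y in a..p.2, f (projIcc c d hcd p.1) (projIcc a b hab y) := by
    apply intervalIntegral.continuous_parametric_intervalIntegral_of_continuous
      (f := fun (p : ℝ × ℝ) y => f (projIcc c d hcd p.1) (projIcc a b hab y))
    · exact hc.comp (by fun_prop : Continuous fun q : (ℝ × ℝ) × ℝ => (q.1.1, q.2))
    · fun_prop
  refine hint.continuousOn.congr fun p hp => intervalIntegral.integral_congr fun y hy => ?_
  rw [uIcc_of_le hp.2.1] at hy
  simp only [projIcc_of_mem hcd hp.1, projIcc_of_mem hab (⟨hy.1, hy.2.trans hp.2.2⟩ : y ∈ Icc a b)]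

/-- A family `f ε` of functions on `[a, b]`, continuous, with a continuous derivative `f'` with
respect to the parameter `ε ∈ [-δ, δ]`. -/
structure IsC1Family (δ a b : ℝ) (f f' : ℝ → ℝ → ℝ) : Prop where
  continuousOn : ContinuousOn (fun p : ℝ × ℝ => f p.1 p.2) (Icc (-δ) δ ×ˢ Icc a b)
  continuousOn_deriv : ContinuousOn (fun p : ℝ × ℝ => f' p.1 p.2) (Icc (-δ) δ ×ˢ Icc a b)
  hasDerivAt : ∀ ε ∈ Ioo (-δ) δ, ∀ x ∈ Icc a b, HasDerivAt (fun e => f e x) (f' ε x) ε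

namespace IsC1Family

variable {δ a b : ℝ} {f f' k k' : ℝ → ℝ → ℝ}

lemma congr_deriv (hf : IsC1Family δ a b f f') (hk : ∀ ε x, f' ε x = k' ε x) :
    IsC1Family δ a b f k' := by
  rwa [← funext₂ hk]

lemma continuousOn_slice (hf : IsC1Family δ a b f f') {ε : ℝ} (hε : ε ∈ Icc (-δ) δ) :
    ContinuousOn (f ε) (Icc a b) :=
  hf.continuousOn.comp (f := fun x => (ε, x)) (by fun_prop) fun _ hx => ⟨hε, hx⟩

lemma continuousOn_deriv_slice (hf : IsC1Family δ a b f f') {ε : ℝ} (hε : ε ∈ Icc (-δ) δ) :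
    ContinuousOn (f' ε) (Icc a b) :=
  hf.continuousOn_deriv.comp (f := fun x => (ε, x)) (by fun_prop) fun _ hx => ⟨hε, hx⟩

lemma const {φ : ℝ → ℝ} (hφ : ContinuousOn φ (Icc a b)) :
    IsC1Family δ a b (fun _ => φ) (fun _ _ => 0) :=
  ⟨hφ.comp continuousOn_snd fun _ hp => hp.2, continuousOn_const,
    fun ε _ x _ => hasDerivAt_const ε (φ x)⟩

lemma add (hf : IsC1Family δ a b f f') (hk : IsC1Family δ a b k k') :
    IsC1Family δ a b (fun ε x => f ε x + k ε x) (fun ε x => f' ε x + k' ε x) :=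
  ⟨hf.continuousOn.add hk.continuousOn, hf.continuousOn_deriv.add hk.continuousOn_deriv,
    fun ε hε x hx => (hf.hasDerivAt ε hε x hx).add (hk.hasDerivAt ε hε x hx)⟩

lemma sub (hf : IsC1Family δ a b f f') (hk : IsC1Family δ a b k k') :
    IsC1Family δ a b (fun ε x => f ε x - k ε x) (fun ε x => f' ε x - k' ε x) :=
  ⟨hf.continuousOn.sub hk.continuousOn, hf.continuousOn_deriv.sub hk.continuousOn_deriv,
    fun ε hε x hx => (hf.hasDerivAt ε hε x hx).sub (hk.hasDerivAt ε hε x hx)⟩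

lemma mul (hf : IsC1Family δ a b f f') (hk : IsC1Family δ a b k k') :
    IsC1Family δ a b (fun ε x => f ε x * k ε x) (fun ε x => f' ε x * k ε x + f ε x * k' ε x) :=
  ⟨hf.continuousOn.mul hk.continuousOn,
    (hf.continuousOn_deriv.mul hk.continuousOn).add (hf.continuousOn.mul hk.continuousOn_deriv),
    fun ε hε x hx => (hf.hasDerivAt ε hε x hx).mul (hk.hasDerivAt ε hε x hx)⟩

lemma const_mul {φ : ℝ → ℝ} (hφ : ContinuousOn φ (Icc a b)) (hf : IsC1Family δ a b f f') :
    IsC1Family δ a b (fun ε x => φ x * f ε x) (fun ε x => φ x * f' ε x) := by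
  simpa only [zero_mul, zero_add] using (const hφ).mul hf

lemma sum {ι : Type*} (s : Finset ι) {F F' : ι → ℝ → ℝ → ℝ}
    (hF : ∀ i, IsC1Family δ a b (F i) (F' i)) :
    IsC1Family δ a b (fun ε x => ∑ i ∈ s, F i ε x) (fun ε x => ∑ i ∈ s, F' i ε x) :=
  ⟨continuousOn_finsetSum _ fun i _ => (hF i).continuousOn,
    continuousOn_finsetSum _ fun i _ => (hF i).continuousOn_deriv,
    fun ε hε x hx => HasDerivAt.fun_sum fun i _ => (hF i).hasDerivAt ε hε x hx⟩

lemma hasDerivAt_integral (hf : IsC1Family δ a b f f') {ε x : ℝ} (hε : ε ∈ Ioo (-δ) δ)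
    (hx : x ∈ Icc a b) :
    HasDerivAt (fun e => ∫ y in a..x, f e y) (∫ y in a..x, f' ε y) ε := by
  obtain ⟨M, hM⟩ := (isCompact_Icc.prod isCompact_Icc).exists_bound_of_continuousOn
    hf.continuousOn_deriv
  have hIcc : uIcc a x ⊆ Icc a b := by
    rw [uIcc_of_le hx.1]
    exact Icc_subset_Icc_right hx.2
  have hIoc : ∀ y ∈ uIoc a x, y ∈ Icc a b := fun y hy => hIcc (uIoc_subset_uIcc hy)
  have hint : ∀ e ∈ Ioo (-δ) δ, IntervalIntegrable (f e) volume a x := fun e he =>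
    ((hf.continuousOn_slice (Ioo_subset_Icc_self he)).mono hIcc).intervalIntegrable
  have hint' : IntervalIntegrable (f' ε) volume a x :=
    ((hf.continuousOn_deriv_slice (Ioo_subset_Icc_self hε)).mono hIcc).intervalIntegrable
  have hnhds := Ioo_mem_nhds hε.1 hε.2
  exact (intervalIntegral.hasDerivAt_integral_of_dominated_loc_of_deriv_le (bound := fun _ => M)
    hnhds (Filter.mem_of_superset hnhds fun e he =>
      (hint e he).aestronglyMeasurable_restrict_uIoc)
    (hint ε hε) hint'.aestronglyMeasurable_restrict_uIoc
    (.of_forall fun y hy e he => hM (e, y) ⟨Ioo_subset_Icc_self he, hIoc y hy⟩)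
    intervalIntegrable_const
    (.of_forall fun y hy e he => hf.hasDerivAt e he y (hIoc y hy))).2

lemma integral (hf : IsC1Family δ a b f f') (hδ : 0 ≤ δ) (hab : a ≤ b) :
    IsC1Family δ a b (fun ε x => ∫ y in a..x, f ε y) (fun ε x => ∫ y in a..x, f' ε y) :=
  ⟨continuousOn_intervalIntegral (neg_le_self hδ) hab hf.continuousOn,
    continuousOn_intervalIntegral (neg_le_self hδ) hab hf.continuousOn_deriv,
    fun _ hε _ hx => hf.hasDerivAt_integral hε hx⟩

lemma total_integral (hf : IsC1Family δ a b f f') (hδ : 0 ≤ δ) (hab : a ≤ b) :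
    IsC1Family δ a b (fun ε _ => ∫ y in a..b, f ε y) (fun ε _ => ∫ y in a..b, f' ε y) := by
  have h := hf.integral hδ hab
  have hmaps : MapsTo (fun p : ℝ × ℝ => (p.1, b)) (Icc (-δ) δ ×ˢ Icc a b)
      (Icc (-δ) δ ×ˢ Icc a b) := fun p hp => ⟨hp.1, right_mem_Icc.2 hab⟩
  exact ⟨h.continuousOn.comp (f := fun p : ℝ × ℝ => (p.1, b)) (by fun_prop) hmaps,
    h.continuousOn_deriv.comp (f := fun p : ℝ × ℝ => (p.1, b)) (by fun_prop) hmaps,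
    fun ε hε _ _ => h.hasDerivAt ε hε b (right_mem_Icc.2 hab)⟩

lemma map_invD (hf : IsC1Family δ a b f f') (hδ : 0 ≤ δ) (hab : a ≤ b)
    (h0 : ∀ ε, ∀ x ∉ Ioo a b, f ε x = 0) (h0' : ∀ ε, ∀ x ∉ Ioo a b, f' ε x = 0) :
    IsC1Family δ a b (fun ε => invD (f ε)) (fun ε => invD (f' ε)) := by
  have hinv {ε : ℝ} (hε : ε ∈ Icc (-δ) δ) (x : ℝ) :
      invD (f ε) x = (∫ y in a..x, f ε y) - (1 / 2 : ℝ) * ∫ y in a..b, f ε y :=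
    invD_eq_intervalIntegral (hf.continuousOn_slice hε) (h0 ε) x
  have hinv' {ε : ℝ} (hε : ε ∈ Icc (-δ) δ) (x : ℝ) :
      invD (f' ε) x = (∫ y in a..x, f' ε y) - (1 / 2 : ℝ) * ∫ y in a..b, f' ε y :=
    invD_eq_intervalIntegral (hf.continuousOn_deriv_slice hε) (h0' ε) x
  have h := (hf.integral hδ hab).sub
    ((hf.total_integral hδ hab).const_mul (φ := fun _ => (1 / 2 : ℝ)) continuousOn_const)
  refine ⟨h.continuousOn.congr fun p hp => hinv hp.1 p.2,
    h.continuousOn_deriv.congr fun p hp => hinv' hp.1 p.2, fun ε hε x hx => ?_⟩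
  rw [hinv' (Ioo_subset_Icc_self hε)]
  refine (h.hasDerivAt ε hε x hx).congr_of_eventuallyEq ?_
  filter_upwards [Ioo_mem_nhds hε.1 hε.2] with e he
  exact hinv (Ioo_subset_Icc_self he) x

end IsC1Family

end Families

section HydroOperators

open Matrix

variable {n : ℕ} {A : Type*} [Fintype A]

/-- The data of a Hamiltonian operator of hydrodynamic type with a diagonal metric and diagonal
affinors: contravariant metric components `q R i`, a torsion free metric connection `Γ R i j k`
and the eigenvalues `W α R i` of affinors satisfying the Gauss and Codazzi equations.  The
involution `σ` says which affinors are paired in a nonlocal term. -/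
structure HydroStructure (U : Set (Fin n → ℝ)) (q : (Fin n → ℝ) → Fin n → ℝ)
    (Γ : (Fin n → ℝ) → Fin n → Fin n → Fin n → ℝ) (W : A → (Fin n → ℝ) → Fin n → ℝ)
    (σ : A → A) : Prop where
  isOpen : IsOpen U
  involutive : Function.Involutive σ
  contDiffOn_metric : ContDiffOn ℝ ∞ q U
  contDiffOn_conn : ContDiffOn ℝ ∞ Γ U
  contDiffOn_affinor : ∀ α, ContDiffOn ℝ ∞ (W α) U
  symm : ∀ R ∈ U, ∀ i j k, Γ R i j k = Γ R i k j
  metric : ∀ R ∈ U, ∀ i j k,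
    (if i = j then pd k (fun S => q S i) R else 0) + Γ R i k j * q R j + Γ R j k i * q R i = 0
  codazzi : ∀ α, ∀ R ∈ U, ∀ i j k,
    (if i = j then pd k (fun S => W α S i) R else 0) + Γ R i k j * W α R j
      = (if i = k then pd j (fun S => W α S i) R else 0) + Γ R i k j * W α R k
  gauss : ∀ R ∈ U, ∀ i j k l, q R j * connCurv (fun i j k S => Γ S i j k) i j k l R
    = (∑ α, W α R i * W (σ α) R j) * ((if i = k then 1 else 0) * (if j = l then 1 else 0)
        - (if i = l then 1 else 0) * (if j = k then 1 else 0))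

/-- The matrix `w^k Γ^j_{ki}` of a connection in the direction `w`, with row `j` and column `i`. -/
def connMatrix (G : Fin n → Fin n → Fin n → ℝ) (w : Fin n → ℝ) : Matrix (Fin n) (Fin n) ℝ :=
  of fun j i => ∑ k, w k * G j k i

/-- The curvature of a connection as a matrix valued bilinear form. -/
def connCurvMatrix (Γ : (Fin n → ℝ) → Fin n → Fin n → Fin n → ℝ) (S u w : Fin n → ℝ) :
    Matrix (Fin n) (Fin n) ℝ :=
  connMatrix (fderiv ℝ Γ S u) w - connMatrix (fderiv ℝ Γ S w) u
    + (connMatrix (Γ S) u * connMatrix (Γ S) w - connMatrix (Γ S) w * connMatrix (Γ S) u)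

/-- The velocity of a field, with the derivative taken in each component. -/
def velocity (R : ℝ → Fin n → ℝ) (x : ℝ) : Fin n → ℝ := fun i => deriv (fun y => R y i) x

/-- The covariant derivative of a covector field `ξ` along a field `R`. -/
def covDerivAlong (Γ : (Fin n → ℝ) → Fin n → Fin n → Fin n → ℝ) (R ξ : ℝ → Fin n → ℝ) (x : ℝ) :
    Fin n → ℝ :=
  velocity ξ x - ξ x ᵥ* connMatrix (Γ (R x)) (velocity R x)

/-- The covariant variation of a covector field `ξ` when the field `R` moves in the direction `V`
and the components of `ξ` do not change. -/
def covVar (Γ : (Fin n → ℝ) → Fin n → Fin n → Fin n → ℝ) (R V ξ : ℝ → Fin n → ℝ) (x : ℝ) :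
    Fin n → ℝ :=
  -(ξ x ᵥ* connMatrix (Γ (R x)) (V x))

/-- The pairing of a covector field `ξ` with the image of `V` under the diagonal affinor `w`. -/
def pairing (w : (Fin n → ℝ) → Fin n → ℝ) (R V ξ : ℝ → Fin n → ℝ) (x : ℝ) : ℝ :=
  ξ x ⬝ᵥ (w (R x) * V x)

/-- The variation of `pairing w R (velocity R) ξ` when `R` moves in the direction `V`. -/
def varPairing (w : (Fin n → ℝ) → Fin n → ℝ) (R V ξ : ℝ → Fin n → ℝ) (x : ℝ) : ℝ :=
  ξ x ⬝ᵥ (fderiv ℝ w (R x) (V x) * velocity R x + w (R x) * velocity V x)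

/-- The nonlocal part of a Hamiltonian operator of hydrodynamic type, as a diagonal affinor which
acts on the velocity of the field. -/
def tail (W : A → (Fin n → ℝ) → Fin n → ℝ) (σ : A → A) (R ξ : ℝ → Fin n → ℝ) (x : ℝ) :
    Fin n → ℝ :=
  ∑ α, invD (pairing (W (σ α)) R (velocity R) ξ) x • W α (R x)

/-- The operator of hydrodynamic type `q^i D_i + ∑_α W_α R_x (d/dx)⁻¹ W_{σ α} R_x`. -/
def hydroOp (q : (Fin n → ℝ) → Fin n → ℝ) (Γ : (Fin n → ℝ) → Fin n → Fin n → Fin n → ℝ)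
    (W : A → (Fin n → ℝ) → Fin n → ℝ) (σ : A → A) (R ξ : ℝ → Fin n → ℝ) (x : ℝ) : Fin n → ℝ :=
  q (R x) * covDerivAlong Γ R ξ x + velocity R x * tail W σ R ξ x

/-- The local part of the density of the bracket defined by `hydroOp`. -/
def localDensity (q : (Fin n → ℝ) → Fin n → ℝ) (Γ : (Fin n → ℝ) → Fin n → Fin n → Fin n → ℝ)
    (R ξ η : ℝ → Fin n → ℝ) (x : ℝ) : ℝ :=
  ξ x ⬝ᵥ (q (R x) * covDerivAlong Γ R η x)

/-- The variation of `localDensity` when `R` moves in the direction `V`. -/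
def varLocalDensity (q : (Fin n → ℝ) → Fin n → ℝ)
    (Γ : (Fin n → ℝ) → Fin n → Fin n → Fin n → ℝ) (R V ξ η : ℝ → Fin n → ℝ) (x : ℝ) : ℝ :=
  ξ x ⬝ᵥ (fderiv ℝ q (R x) (V x) * covDerivAlong Γ R η x
    - q (R x) * (η x ᵥ* (connMatrix (fderiv ℝ Γ (R x) (V x)) (velocity R x)
      + connMatrix (Γ (R x)) (velocity V x))))

section Algebra

variable {q w : (Fin n → ℝ) → Fin n → ℝ} {Γ : (Fin n → ℝ) → Fin n → Fin n → Fin n → ℝ}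
  {W : A → (Fin n → ℝ) → Fin n → ℝ} {σ : A → A} {R V ξ η : ℝ → Fin n → ℝ} {S : Fin n → ℝ} {x : ℝ}

lemma sum_mul_comp_involutive (hσ : Function.Involutive σ) (f k : A → ℝ) :
    ∑ α, f α * k (σ α) = ∑ α, k α * f (σ α) := by
  rw [← Equiv.sum_comp hσ.toPerm]
  exact Finset.sum_congr rfl fun α _ => by
    rw [Function.Involutive.coe_toPerm, hσ α, mul_comm]

lemma dotProduct_mul_comm (u d z : Fin n → ℝ) : u ⬝ᵥ (d * z) = z ⬝ᵥ (d * u) := by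
  rw [dotProduct_comm]
  exact Finset.sum_congr rfl fun i _ => by simp only [Pi.mul_apply]; ring

lemma fderiv_apply_eq_sum_pd (hw : DifferentiableAt ℝ w S) (u : Fin n → ℝ) (i : Fin n) :
    fderiv ℝ w S u i = ∑ k, pd k (fun S => w S i) S * u k := by
  rw [← fderiv_eq_sum_pd]
  exact (DFunLike.congr_fun ((hasFDerivAt_apply i (w S)).comp S hw.hasFDerivAt).fderiv u).symm

lemma fderiv_conn_apply (hΓ : DifferentiableAt ℝ Γ S) (u : Fin n → ℝ) (i j k : Fin n) :
    fderiv ℝ Γ S u i j k = ∑ p, pd p (fun S => Γ S i j k) S * u p := by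
  have h := (hasFDerivAt_apply k (Γ S i j)).comp S
    ((hasFDerivAt_apply j (Γ S i)).comp S ((hasFDerivAt_apply i (Γ S)).comp S hΓ.hasFDerivAt))
  rw [← fderiv_eq_sum_pd]
  exact (DFunLike.congr_fun h.fderiv u).symm

lemma connMatrix_fderiv_apply (hΓ : DifferentiableAt ℝ Γ S) (u w : Fin n → ℝ) (m i : Fin n) :
    connMatrix (fderiv ℝ Γ S u) w m i
      = ∑ p, ∑ k, u p * w k * pd p (fun S => Γ S m k i) S := by
  simp only [connMatrix, of_apply, fderiv_conn_apply hΓ, Finset.mul_sum]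
  rw [Finset.sum_comm]
  exact Finset.sum_congr rfl fun p _ => Finset.sum_congr rfl fun k _ => by ring

lemma connMatrix_mul_apply (G : Fin n → Fin n → Fin n → ℝ) (u w : Fin n → ℝ) (m i : Fin n) :
    (connMatrix G u * connMatrix G w) m i
      = ∑ p, ∑ k, u p * w k * ∑ j, G m p j * G j k i := by
  simp only [connMatrix, Matrix.mul_apply, of_apply, Finset.sum_mul, Finset.mul_sum]
  rw [Finset.sum_comm_cycle]
  refine Finset.sum_congr rfl fun p _ => ?_
  rw [Finset.sum_comm]
  exact Finset.sum_congr rfl fun k _ => Finset.sum_congr rfl fun j _ => by ring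

lemma connCurvMatrix_apply (hΓ : DifferentiableAt ℝ Γ S) (u w : Fin n → ℝ) (m i : Fin n) :
    connCurvMatrix Γ S u w m i
      = ∑ p, ∑ k, u p * w k * connCurv (fun i j k S => Γ S i j k) m i p k S := by
  have swap (f : Fin n → Fin n → ℝ) :
      ∑ p, ∑ k, w p * u k * f p k = ∑ p, ∑ k, u p * w k * f k p := by
    rw [Finset.sum_comm]
    exact Finset.sum_congr rfl fun p _ => Finset.sum_congr rfl fun k _ => by ring
  simp only [connCurvMatrix, Matrix.add_apply, Matrix.sub_apply, connMatrix_fderiv_apply hΓ,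
    connMatrix_mul_apply, swap, connCurv, ← Finset.sum_sub_distrib, ← Finset.sum_add_distrib,
    ← mul_sub, ← mul_add]

lemma pairing_eq_zero (h : ξ x = 0) : pairing w R V ξ x = 0 := by
  simp [pairing, h]

lemma varPairing_eq_zero (h : ξ x = 0) : varPairing w R V ξ x = 0 := by
  simp [varPairing, h]

lemma hasCompactSupport_pairing (hξ : HasCompactSupport ξ) : HasCompactSupport (pairing w R V ξ) :=
  hasCompactSupport_of_eq_zero hξ fun _ => pairing_eq_zero

lemma hasCompactSupport_varPairing (hξ : HasCompactSupport ξ) :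
    HasCompactSupport (varPairing w R V ξ) :=
  hasCompactSupport_of_eq_zero hξ fun _ => varPairing_eq_zero

lemma localDensity_eq_zero (h : ξ x = 0) : localDensity q Γ R ξ η x = 0 := by
  simp [localDensity, h]

lemma varLocalDensity_eq_zero (h : ξ x = 0) : varLocalDensity q Γ R V ξ η x = 0 := by
  simp [varLocalDensity, h]

lemma dotProduct_mul_tail (u z : Fin n → ℝ) :
    u ⬝ᵥ (z * tail W σ R η x)
      = ∑ α, u ⬝ᵥ (W α (R x) * z) * invD (pairing (W (σ α)) R (velocity R) η) x := by
  simp only [tail, mul_comm z, Finset.sum_mul, dotProduct_sum, smul_mul_assoc, dotProduct_smul,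
    smul_eq_mul, mul_comm (invD _ _)]

lemma dotProduct_hydroOp (ξ η : ℝ → Fin n → ℝ) (x : ℝ) :
    ξ x ⬝ᵥ hydroOp q Γ W σ R η x = localDensity q Γ R ξ η x
      + ∑ α, pairing (W α) R (velocity R) ξ x
        * invD (pairing (W (σ α)) R (velocity R) η) x := by
  rw [hydroOp, dotProduct_add, dotProduct_mul_tail]
  rfl

end Algebra

namespace HydroStructure

variable {U : Set (Fin n → ℝ)} {q : (Fin n → ℝ) → Fin n → ℝ}
  {Γ : (Fin n → ℝ) → Fin n → Fin n → Fin n → ℝ} {W : A → (Fin n → ℝ) → Fin n → ℝ}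
  {σ : A → A} {S : Fin n → ℝ}

lemma differentiableAt_metric (H : HydroStructure U q Γ W σ) (hS : S ∈ U) :
    DifferentiableAt ℝ q S :=
  differentiableAt_of_mem H.isOpen H.contDiffOn_metric hS

lemma differentiableAt_conn (H : HydroStructure U q Γ W σ) (hS : S ∈ U) :
    DifferentiableAt ℝ Γ S :=
  differentiableAt_of_mem H.isOpen H.contDiffOn_conn hS

lemma differentiableAt_affinor (H : HydroStructure U q Γ W σ) (hS : S ∈ U) (α : A) :
    DifferentiableAt ℝ (W α) S :=
  differentiableAt_of_mem H.isOpen (H.contDiffOn_affinor α) hS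

lemma connMatrix_mulVec_comm (H : HydroStructure U q Γ W σ) (hS : S ∈ U) (u w : Fin n → ℝ) :
    connMatrix (Γ S) u *ᵥ w = connMatrix (Γ S) w *ᵥ u := by
  funext j
  simp only [connMatrix, mulVec, dotProduct, of_apply, Finset.sum_mul]
  rw [Finset.sum_comm]
  exact Finset.sum_congr rfl fun i _ => Finset.sum_congr rfl fun k _ => by
    rw [H.symm S hS j i k]
    ring

lemma diagonal_fderiv_metric_add (H : HydroStructure U q Γ W σ) (hS : S ∈ U) (w : Fin n → ℝ) :
    diagonal (fderiv ℝ q S w) + connMatrix (Γ S) w * diagonal (q S)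
      + (connMatrix (Γ S) w * diagonal (q S))ᵀ = 0 := by
  ext i j
  have h : ∑ k, w k * ((if i = j then pd k (fun S => q S i) S else 0) + Γ S i k j * q S j
      + Γ S j k i * q S i) = 0 :=
    Finset.sum_eq_zero fun k _ => by rw [H.metric S hS, mul_zero]
  simp only [mul_add, Finset.sum_add_distrib, ← mul_assoc, ← Finset.sum_mul] at h
  simp only [Matrix.add_apply, diagonal_apply, transpose_apply, mul_diagonal, connMatrix,
    of_apply, Matrix.zero_apply, fderiv_apply_eq_sum_pd (H.differentiableAt_metric hS)]
  refine Eq.trans ?_ h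
  congr 2
  split_ifs <;> simp [mul_comm]

lemma fderiv_metric_add (H : HydroStructure U q Γ W σ) (hS : S ∈ U) (w ξ η : Fin n → ℝ) :
    ξ ⬝ᵥ (fderiv ℝ q S w * η) + (ξ ᵥ* connMatrix (Γ S) w) ⬝ᵥ (q S * η)
      + ξ ⬝ᵥ (q S * (η ᵥ* connMatrix (Γ S) w)) = 0 := by
  have mulVec_diag (d z : Fin n → ℝ) : diagonal d *ᵥ z = d * z :=
    funext fun i => mulVec_diagonal d z i
  have h := congrArg (fun M => ξ ⬝ᵥ (M *ᵥ η)) (H.diagonal_fderiv_metric_add hS w)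
  simpa only [add_mulVec, dotProduct_add, ← mulVec_mulVec, transpose_mul, diagonal_transpose,
    mulVec_transpose, mulVec_diag, dotProduct_mulVec ξ (connMatrix _ _), zero_mulVec,
    dotProduct_zero] using h

lemma fderiv_affinor_add (H : HydroStructure U q Γ W σ) (hS : S ∈ U) (u w : Fin n → ℝ) (α : A) :
    fderiv ℝ (W α) S u * w + connMatrix (Γ S) u *ᵥ (W α S * w)
      = fderiv ℝ (W α) S w * u + connMatrix (Γ S) w *ᵥ (W α S * u) := by
  have expand (u w : Fin n → ℝ) (j : Fin n) :
      (fderiv ℝ (W α) S u * w + connMatrix (Γ S) u *ᵥ (W α S * w)) j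
        = ∑ i, ∑ k, u k * w i * ((if j = i then pd k (fun S => W α S j) S else 0)
          + Γ S j k i * W α S i) := by
    simp only [Pi.add_apply, Pi.mul_apply, mulVec, dotProduct, connMatrix, of_apply, mul_add,
      Finset.sum_add_distrib, mul_ite, mul_zero, Finset.sum_ite_irrel, Finset.sum_const_zero,
      Finset.sum_ite_eq, Finset.mem_univ, if_true, Finset.sum_mul,
      fderiv_apply_eq_sum_pd (H.differentiableAt_affinor hS α)]
    congr 1
    · exact Finset.sum_congr rfl fun k _ => by ring
    · exact Finset.sum_congr rfl fun i _ => Finset.sum_congr rfl fun k _ => by ring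
  funext j
  rw [expand, expand, Finset.sum_comm]
  refine Finset.sum_congr rfl fun k _ => Finset.sum_congr rfl fun i _ => ?_
  rw [H.codazzi α S hS, H.symm S hS j k i, mul_comm (u k)]

lemma metric_mul_connCurvMatrix (H : HydroStructure U q Γ W σ) (hS : S ∈ U) (u w : Fin n → ℝ)
    (m i : Fin n) : q S i * connCurvMatrix Γ S u w m i
      = (∑ α, W α S m * W (σ α) S i) * (u m * w i - w m * u i) := by
  simp only [connCurvMatrix_apply (H.differentiableAt_conn hS), Finset.mul_sum,
    mul_left_comm (q S i), H.gauss S hS]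
  generalize ∑ α, W α S m * W (σ α) S i = c
  simp only [mul_sub, Finset.sum_sub_distrib, ← mul_assoc, mul_ite, mul_one, mul_zero,
    Finset.sum_ite_eq, Finset.mem_univ, if_true, Finset.sum_ite_irrel, Finset.sum_const_zero]
  ring

lemma dotProduct_connCurvMatrix (H : HydroStructure U q Γ W σ) (hS : S ∈ U)
    (u w ξ η : Fin n → ℝ) :
    ξ ⬝ᵥ (q S * (η ᵥ* connCurvMatrix Γ S u w))
      = ∑ α, (ξ ⬝ᵥ (W α S * w) * (η ⬝ᵥ (W (σ α) S * u))
        - η ⬝ᵥ (W α S * w) * (ξ ⬝ᵥ (W (σ α) S * u))) := by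
  have entry (i m : Fin n) : ξ i * (q S i * (η m * connCurvMatrix Γ S u w m i))
      = ∑ α, (ξ i * (W (σ α) S i * w i) * (η m * (W α S m * u m))
        - ξ i * (W (σ α) S i * u i) * (η m * (W α S m * w m))) := by
    rw [mul_left_comm (q S i), H.metric_mul_connCurvMatrix hS, Finset.sum_mul, Finset.mul_sum,
      Finset.mul_sum]
    exact Finset.sum_congr rfl fun α _ => by ring
  have expand : ξ ⬝ᵥ (q S * (η ᵥ* connCurvMatrix Γ S u w))
      = ∑ α, ((ξ ⬝ᵥ (W (σ α) S * w)) * (η ⬝ᵥ (W α S * u))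
        - (ξ ⬝ᵥ (W (σ α) S * u)) * (η ⬝ᵥ (W α S * w))) := by
    simp only [dotProduct, vecMul, Pi.mul_apply, Finset.sum_mul_sum, ← Finset.sum_sub_distrib]
    simp only [Finset.mul_sum, entry]
    rw [Finset.sum_comm_cycle]
  rw [expand, Finset.sum_sub_distrib, Finset.sum_sub_distrib,
    sum_mul_comp_involutive H.involutive (fun α => ξ ⬝ᵥ (W α S * w)) fun α => η ⬝ᵥ (W α S * u)]
  simp only [mul_comm]

end HydroStructure

end HydroOperators

section SmoothCurves

open Matrix

variable {n : ℕ} {U : Set (Fin n → ℝ)} {R V ξ η : ℝ → Fin n → ℝ}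

lemma hasDerivAt_velocity (hξ : ContDiff ℝ ∞ ξ) (x : ℝ) : HasDerivAt ξ (velocity ξ x) x :=
  hasDerivAt_pi.2 fun i =>
    ((contDiff_pi.1 hξ i).differentiable (by simp) x).hasDerivAt

lemma contDiff_velocity (hξ : ContDiff ℝ ∞ ξ) : ContDiff ℝ ∞ (velocity ξ) :=
  contDiff_pi.2 fun i => (contDiff_infty_iff_deriv.1 (contDiff_pi.1 hξ i)).2

lemma contDiff_dotProduct (hξ : ContDiff ℝ ∞ ξ) (hη : ContDiff ℝ ∞ η) :
    ContDiff ℝ ∞ fun x => ξ x ⬝ᵥ η x :=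
  ContDiff.sum fun i _ => (contDiff_pi.1 hξ i).mul (contDiff_pi.1 hη i)

lemma hasDerivAt_dotProduct {ξ' η' : Fin n → ℝ} {x : ℝ} (hξ : HasDerivAt ξ ξ' x)
    (hη : HasDerivAt η η' x) :
    HasDerivAt (fun y => ξ y ⬝ᵥ η y) (ξ' ⬝ᵥ η x + ξ x ⬝ᵥ η') x :=
  (HasDerivAt.fun_sum fun i (_ : i ∈ Finset.univ) =>
    (hasDerivAt_pi.1 hξ i).fun_mul (hasDerivAt_pi.1 hη i)).congr_deriv Finset.sum_add_distrib

lemma hasCompactSupport_velocity (hξ : IsTest ξ) : HasCompactSupport (velocity ξ) := by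
  rw [← funext fun x => (hasDerivAt_velocity hξ.1 x).deriv]
  exact hξ.2.deriv

variable {G : ℝ → Fin n → Fin n → Fin n → ℝ}

lemma contDiff_vecMul_connMatrix (hξ : ContDiff ℝ ∞ ξ) (hG : ContDiff ℝ ∞ G)
    (hV : ContDiff ℝ ∞ V) : ContDiff ℝ ∞ fun x => ξ x ᵥ* connMatrix (G x) (V x) :=
  contDiff_pi.2 fun i => contDiff_dotProduct hξ <| contDiff_pi.2 fun j =>
    contDiff_dotProduct (η := fun x k => G x j k i) hV <| contDiff_pi.2 fun k =>
      contDiff_pi.1 (contDiff_pi.1 (contDiff_pi.1 hG j) k) i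

lemma hasDerivAt_vecMul_connMatrix {ξ' V' : Fin n → ℝ} {G' : Fin n → Fin n → Fin n → ℝ} {x : ℝ}
    (hξ : HasDerivAt ξ ξ' x) (hG : HasDerivAt G G' x) (hV : HasDerivAt V V' x) :
    HasDerivAt (fun y => ξ y ᵥ* connMatrix (G y) (V y))
      (ξ' ᵥ* connMatrix (G x) (V x)
        + ξ x ᵥ* (connMatrix G' (V x) + connMatrix (G x) V')) x := by
  have hconn (j i : Fin n) : HasDerivAt (fun y => connMatrix (G y) (V y) j i)
      ((connMatrix G' (V x) + connMatrix (G x) V') j i) x :=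
    (HasDerivAt.fun_sum fun k (_ : k ∈ Finset.univ) => (hasDerivAt_pi.1 hV k).fun_mul
      (hasDerivAt_pi.1 (hasDerivAt_pi.1 (hasDerivAt_pi.1 hG j) k) i)).congr_deriv <|
        Finset.sum_add_distrib.trans (add_comm _ _)
  exact hasDerivAt_pi.2 fun i => hasDerivAt_dotProduct hξ (hasDerivAt_pi.2 fun j => hconn j i)

variable {E : Type*} [NormedAddCommGroup E] [NormedSpace ℝ E] {f : (Fin n → ℝ) → E}

lemma hasDerivAt_comp_curve (hU : IsOpen U) (hf : ContDiffOn ℝ ∞ f U) (hR : ContDiff ℝ ∞ R)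
    (hRU : ∀ x, R x ∈ U) (x : ℝ) :
    HasDerivAt (fun y => f (R y)) (fderiv ℝ f (R x) (velocity R x)) x :=
  (differentiableAt_of_mem hU hf (hRU x)).hasFDerivAt.comp_hasDerivAt x (hasDerivAt_velocity hR x)

lemma contDiff_fderiv_comp_curve (hU : IsOpen U) (hf : ContDiffOn ℝ ∞ f U) (hR : ContDiff ℝ ∞ R)
    (hRU : ∀ x, R x ∈ U) (hV : ContDiff ℝ ∞ V) :
    ContDiff ℝ ∞ fun x => fderiv ℝ f (R x) (V x) :=
  ((hf.fderiv_of_isOpen hU (m := ∞) (by simp)).comp_contDiff hR hRU).clm_apply hV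

end SmoothCurves

section Perturbation

variable {n : ℕ} {U : Set (Fin n → ℝ)} {R V : ℝ → Fin n → ℝ} {δ a b : ℝ}

lemma exists_perturbation_mem (hU : IsOpen U) (hR : Continuous R) (hV : Continuous V)
    (hRU : ∀ x, R x ∈ U) (a b : ℝ) :
    ∃ δ : ℝ, 0 < δ ∧ ∀ ε ∈ Icc (-δ) δ, ∀ x ∈ Icc a b, R x + ε • V x ∈ U := by
  have hopen : IsOpen {p : ℝ × ℝ | R p.2 + p.1 • V p.2 ∈ U} := hU.preimage (by fun_prop)
  have hslice : {(0 : ℝ)} ×ˢ Icc a b ⊆ {p : ℝ × ℝ | R p.2 + p.1 • V p.2 ∈ U} := by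
    rintro ⟨_, x⟩ ⟨rfl, -⟩
    simp [hRU x]
  obtain ⟨u, v, hu, -, h0, hv, huv⟩ :=
    generalized_tube_lemma isCompact_singleton isCompact_Icc hopen hslice
  obtain ⟨δ, hδ, hs⟩ := Metric.nhds_basis_closedBall.mem_iff.1
    (hu.mem_nhds (h0 (mem_singleton (0 : ℝ))))
  rw [Real.closedBall_eq_Icc, zero_sub, zero_add] at hs
  exact ⟨δ, hδ, fun ε hε x hx => huv (mk_mem_prod (hs hε) (hv hx))⟩

lemma velocity_add_smul (hR : ContDiff ℝ ∞ R) (hV : ContDiff ℝ ∞ V) (ε x : ℝ) :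
    velocity (fun y => R y + ε • V y) x = velocity R x + ε • velocity V x :=
  funext fun i => (hasDerivAt_pi.1
    ((hasDerivAt_velocity hR x).fun_add ((hasDerivAt_velocity hV x).const_smul ε)) i).deriv

lemma isC1Family_velocity (hR : ContDiff ℝ ∞ R) (hV : ContDiff ℝ ∞ V) (i : Fin n) :
    IsC1Family δ a b (fun ε x => velocity (fun y => R y + ε • V y) x i)
      (fun _ x => velocity V x i) := by
  have hcR := (contDiff_velocity hR).continuous
  have hcV := (contDiff_velocity hV).continuous
  simp only [velocity_add_smul hR hV]
  exact ⟨by fun_prop, by fun_prop, fun ε _ x _ => by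
    simpa using ((hasDerivAt_id ε).mul_const (velocity V x i)).const_add (velocity R x i)⟩

lemma isC1Family_comp {E : Type*} [NormedAddCommGroup E] [NormedSpace ℝ E]
    {f : (Fin n → ℝ) → E} (hU : IsOpen U) (hf : ContDiffOn ℝ ∞ f U) (hR : Continuous R)
    (hV : Continuous V) (hmem : ∀ ε ∈ Icc (-δ) δ, ∀ x ∈ Icc a b, R x + ε • V x ∈ U)
    (ℓ : E →L[ℝ] ℝ) :
    IsC1Family δ a b (fun ε x => ℓ (f (R x + ε • V x)))
      (fun ε x => ℓ (fderiv ℝ f (R x + ε • V x) (V x))) := by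
  have hc : Continuous fun p : ℝ × ℝ => R p.2 + p.1 • V p.2 := by fun_prop
  have hm : MapsTo (fun p : ℝ × ℝ => R p.2 + p.1 • V p.2) (Icc (-δ) δ ×ˢ Icc a b) U :=
    fun p hp => hmem p.1 hp.1 p.2 hp.2
  have hfderiv := ((hf.fderiv_of_isOpen hU (m := ∞) (by simp)).continuousOn.comp hc.continuousOn
    hm).clm_apply (hV.comp continuous_snd).continuousOn
  refine ⟨ℓ.continuous.comp_continuousOn (hf.continuousOn.comp hc.continuousOn hm),
    ℓ.continuous.comp_continuousOn hfderiv, fun ε hε x hx => ?_⟩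
  have hline : HasDerivAt (fun e : ℝ => R x + e • V x) (V x) ε := by
    simpa using ((hasDerivAt_id ε).smul_const (V x)).const_add (R x)
  exact ℓ.hasFDerivAt.comp_hasDerivAt ε ((differentiableAt_of_mem hU hf
    (hmem ε (Ioo_subset_Icc_self hε) x hx)).hasFDerivAt.comp_hasDerivAt ε hline)

end Perturbation

namespace HydroStructure

open Matrix

variable {n : ℕ} {A : Type*} {U : Set (Fin n → ℝ)} [Fintype A]
  {q : (Fin n → ℝ) → Fin n → ℝ} {Γ : (Fin n → ℝ) → Fin n → Fin n → Fin n → ℝ}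
  {W : A → (Fin n → ℝ) → Fin n → ℝ} {σ : A → A} {R V ξ η : ℝ → Fin n → ℝ}

variable (H : HydroStructure U q Γ W σ) (hR : ContDiff ℝ ∞ R) (hRU : ∀ x, R x ∈ U)
include H hR hRU

lemma contDiff_covDerivAlong (hξ : ContDiff ℝ ∞ ξ) : ContDiff ℝ ∞ (covDerivAlong Γ R ξ) :=
  (contDiff_velocity hξ).sub <| contDiff_vecMul_connMatrix hξ
    (H.contDiffOn_conn.comp_contDiff hR hRU) (contDiff_velocity hR)

lemma contDiff_covVar (hV : ContDiff ℝ ∞ V) (hξ : ContDiff ℝ ∞ ξ) :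
    ContDiff ℝ ∞ (covVar Γ R V ξ) :=
  (contDiff_vecMul_connMatrix hξ (H.contDiffOn_conn.comp_contDiff hR hRU) hV).neg

lemma contDiff_pairing (hV : ContDiff ℝ ∞ V) (hξ : ContDiff ℝ ∞ ξ) (α : A) :
    ContDiff ℝ ∞ (pairing (W α) R V ξ) :=
  contDiff_dotProduct hξ (((H.contDiffOn_affinor α).comp_contDiff hR hRU).mul hV)

lemma contDiff_varPairing (hV : ContDiff ℝ ∞ V) (hξ : ContDiff ℝ ∞ ξ) (α : A) :
    ContDiff ℝ ∞ (varPairing (W α) R V ξ) :=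
  contDiff_dotProduct hξ <|
    ((contDiff_fderiv_comp_curve H.isOpen (H.contDiffOn_affinor α) hR hRU hV).mul
      (contDiff_velocity hR)).add
        (((H.contDiffOn_affinor α).comp_contDiff hR hRU).mul (contDiff_velocity hV))

lemma contDiff_localDensity (hξ : ContDiff ℝ ∞ ξ) (hη : ContDiff ℝ ∞ η) :
    ContDiff ℝ ∞ (localDensity q Γ R ξ η) :=
  contDiff_dotProduct hξ
    ((H.contDiffOn_metric.comp_contDiff hR hRU).mul (H.contDiff_covDerivAlong hR hRU hη))

lemma contDiff_varLocalDensity (hV : ContDiff ℝ ∞ V) (hξ : ContDiff ℝ ∞ ξ) (hη : ContDiff ℝ ∞ η) :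
    ContDiff ℝ ∞ (varLocalDensity q Γ R V ξ η) := by
  have hconn := (contDiff_vecMul_connMatrix hη
    (contDiff_fderiv_comp_curve H.isOpen H.contDiffOn_conn hR hRU hV)
      (contDiff_velocity hR)).add (contDiff_vecMul_connMatrix hη
        (H.contDiffOn_conn.comp_contDiff hR hRU) (contDiff_velocity hV))
  simp only [← vecMul_add] at hconn
  exact contDiff_dotProduct hξ <|
    ((contDiff_fderiv_comp_curve H.isOpen H.contDiffOn_metric hR hRU hV).mul
      (H.contDiff_covDerivAlong hR hRU hη)).sub
        ((H.contDiffOn_metric.comp_contDiff hR hRU).mul hconn)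

lemma contDiff_invD_pairing (hξ : IsTest ξ) (α : A) :
    ContDiff ℝ ∞ (invD (pairing (W α) R (velocity R) ξ)) :=
  contDiff_invD (H.contDiff_pairing hR hRU (contDiff_velocity hR) hξ.1 α)
    (hasCompactSupport_pairing hξ.2)

lemma contDiff_tail (hξ : IsTest ξ) : ContDiff ℝ ∞ (tail W σ R ξ) :=
  ContDiff.sum fun α _ =>
    (H.contDiff_invD_pairing hR hRU hξ (σ α)).smul ((H.contDiffOn_affinor α).comp_contDiff hR hRU)

lemma contDiff_hydroOp (hξ : IsTest ξ) : ContDiff ℝ ∞ (hydroOp q Γ W σ R ξ) :=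
  ((H.contDiffOn_metric.comp_contDiff hR hRU).mul (H.contDiff_covDerivAlong hR hRU hξ.1)).add
    ((contDiff_velocity hR).mul (H.contDiff_tail hR hRU hξ))

lemma hasDerivAt_pairing (hV : ContDiff ℝ ∞ V) (hξ : ContDiff ℝ ∞ ξ) (α : A) (x : ℝ) :
    HasDerivAt (pairing (W α) R V ξ)
      (varPairing (W α) R V ξ x - pairing (W α) R (velocity R) (covVar Γ R V ξ) x
        + pairing (W α) R V (covDerivAlong Γ R ξ) x) x := by
  refine (hasDerivAt_dotProduct (hasDerivAt_velocity hξ x)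
    ((hasDerivAt_comp_curve H.isOpen (H.contDiffOn_affinor α) hR hRU x).mul
      (hasDerivAt_velocity hV x))).congr_deriv ?_
  have hcodazzi := congrArg (fun z => ξ x ⬝ᵥ z)
    (H.fderiv_affinor_add (hRU x) (velocity R x) (V x) α)
  simp only [dotProduct_add, dotProduct_mulVec] at hcodazzi
  simp only [varPairing, pairing, covVar, covDerivAlong, dotProduct_add, neg_dotProduct,
    sub_dotProduct]
  linear_combination hcodazzi

lemma hasDerivAt_dotProduct_metric_mul (hξ : ContDiff ℝ ∞ ξ) (hη : ContDiff ℝ ∞ η) (x : ℝ) :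
    HasDerivAt (fun y => ξ y ⬝ᵥ (q (R y) * η y))
      (localDensity q Γ R ξ η x + localDensity q Γ R η ξ x) x := by
  refine (hasDerivAt_dotProduct (hasDerivAt_velocity hξ x)
    ((hasDerivAt_comp_curve H.isOpen H.contDiffOn_metric hR hRU x).mul
      (hasDerivAt_velocity hη x))).congr_deriv ?_
  have hmetric := H.fderiv_metric_add (hRU x) (velocity R x) (ξ x) (η x)
  simp only [localDensity, dotProduct_mul_comm (η x), covDerivAlong, mul_sub, dotProduct_add,
    dotProduct_sub]
  linear_combination hmetric

lemma covDerivAlong_covVar (hV : ContDiff ℝ ∞ V) (hη : ContDiff ℝ ∞ η) (x : ℝ) :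
    covDerivAlong Γ R (covVar Γ R V η) x
      = -(η x ᵥ* (connMatrix (fderiv ℝ Γ (R x) (V x)) (velocity R x)
          + connMatrix (Γ (R x)) (velocity V x)))
        - covDerivAlong Γ R η x ᵥ* connMatrix (Γ (R x)) (V x)
        - η x ᵥ* connCurvMatrix Γ (R x) (velocity R x) (V x) := by
  have hderiv := (hasDerivAt_vecMul_connMatrix (hasDerivAt_velocity hη x)
    (hasDerivAt_comp_curve H.isOpen H.contDiffOn_conn hR hRU x) (hasDerivAt_velocity hV x)).neg
  have hvelocity : velocity (covVar Γ R V η) x = _ :=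
    funext fun i => (hasDerivAt_pi.1 hderiv i).deriv
  simp only [covDerivAlong, hvelocity, covVar, connCurvMatrix, vecMul_add, vecMul_sub, neg_vecMul,
    sub_vecMul, vecMul_vecMul]
  abel

lemma localDensity_covVar (hV : ContDiff ℝ ∞ V) (hη : ContDiff ℝ ∞ η) (x : ℝ) :
    localDensity q Γ R ξ (covVar Γ R V η) x
      = varLocalDensity q Γ R V ξ η x - localDensity q Γ R (covVar Γ R V ξ) η x
        - ∑ α, (pairing (W α) R V ξ x * pairing (W (σ α)) R (velocity R) η x
          - pairing (W α) R V η x * pairing (W (σ α)) R (velocity R) ξ x) := by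
  have hgauss := H.dotProduct_connCurvMatrix (hRU x) (velocity R x) (V x) (ξ x) (η x)
  have hmetric := H.fderiv_metric_add (hRU x) (V x) (ξ x) (covDerivAlong Γ R η x)
  simp only [pairing, ← hgauss, localDensity, varLocalDensity,
    H.covDerivAlong_covVar hR hRU hV hη, covVar, mul_sub, mul_neg, dotProduct_sub,
    dotProduct_neg, neg_dotProduct]
  linear_combination -hmetric

end HydroStructure

section SkewSums

variable {A : Type*} [Fintype A] {σ : A → A} {f k : A → ℝ → ℝ}

lemma hasCompactSupport_sum_mul (hf : ∀ α, HasCompactSupport (f α)) (k : A → ℝ → ℝ) :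
    HasCompactSupport fun x => ∑ α, f α x * k α x := by
  have h : HasCompactSupport (∑ α, f α * k α) :=
    HasCompactSupport.finset_sum fun α _ => (hf α).mul_right
  rwa [Finset.sum_fn] at h

lemma contDiff_sum_mul_invD (hf : ∀ α, ContDiff ℝ ∞ (f α)) (hk : ∀ α, ContDiff ℝ ∞ (k α))
    (hks : ∀ α, HasCompactSupport (k α)) :
    ContDiff ℝ ∞ fun x => ∑ α, f α x * invD (k (σ α)) x :=
  ContDiff.sum fun α _ => (hf α).mul (contDiff_invD (hk (σ α)) (hks (σ α)))

lemma integrable_sum_mul_invD (hf : ∀ α, ContDiff ℝ ∞ (f α)) (hfs : ∀ α, HasCompactSupport (f α))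
    (hk : ∀ α, ContDiff ℝ ∞ (k α)) (hks : ∀ α, HasCompactSupport (k α)) :
    Integrable fun x => ∑ α, f α x * invD (k (σ α)) x :=
  integrable_finsetSum _ fun α _ =>
    integrable_mul_invD (hf α) (hfs α) (hk (σ α)) (hks (σ α))

lemma integral_sum_mul_invD (hσ : Function.Involutive σ) (hf : ∀ α, ContDiff ℝ ∞ (f α))
    (hfs : ∀ α, HasCompactSupport (f α)) (hk : ∀ α, ContDiff ℝ ∞ (k α))
    (hks : ∀ α, HasCompactSupport (k α)) :
    ∫ x, ∑ α, f α x * invD (k (σ α)) x = -∫ x, ∑ α, k α x * invD (f (σ α)) x := by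
  rw [integral_finsetSum _ fun α _ => integrable_mul_invD (hf α) (hfs α) (hk (σ α)) (hks (σ α)),
    integral_finsetSum _ fun α _ => integrable_mul_invD (hk α) (hks α) (hf (σ α)) (hfs (σ α)),
    ← Equiv.sum_comp hσ.toPerm, ← Finset.sum_neg_distrib]
  refine Finset.sum_congr rfl fun α _ => ?_
  rw [Function.Involutive.coe_toPerm, hσ α]
  exact integral_mul_invD (hf _) (hfs _) (hk _) (hks _)

end SkewSums

section CovariantVariation

open Matrix

variable {n : ℕ} {A : Type*} [Fintype A]

/-- The density of the variation of the bracket when `R` moves in the direction `V`, after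
`(d/dx)⁻¹` has been moved away from the varied factors by its skew-symmetry. -/
def variationDensity (q : (Fin n → ℝ) → Fin n → ℝ) (Γ : (Fin n → ℝ) → Fin n → Fin n → Fin n → ℝ)
    (W : A → (Fin n → ℝ) → Fin n → ℝ) (σ : A → A) (R V ξ η : ℝ → Fin n → ℝ) (x : ℝ) : ℝ :=
  varLocalDensity q Γ R V ξ η x
    + ∑ α, varPairing (W α) R V ξ x * invD (pairing (W (σ α)) R (velocity R) η) x
    - ∑ α, varPairing (W α) R V η x * invD (pairing (W (σ α)) R (velocity R) ξ) x

/-- The variation of the bracket when `R` moves in the direction `V`, as a density without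
derivatives of `V`. -/
def covVariation (q : (Fin n → ℝ) → Fin n → ℝ) (Γ : (Fin n → ℝ) → Fin n → Fin n → Fin n → ℝ)
    (W : A → (Fin n → ℝ) → Fin n → ℝ) (σ : A → A) (R V ξ η : ℝ → Fin n → ℝ) (x : ℝ) : ℝ :=
  covVar Γ R V ξ x ⬝ᵥ hydroOp q Γ W σ R η x - covVar Γ R V η x ⬝ᵥ hydroOp q Γ W σ R ξ x
    + (covDerivAlong Γ R η x ⬝ᵥ (V x * tail W σ R ξ x)
      - covDerivAlong Γ R ξ x ⬝ᵥ (V x * tail W σ R η x))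

/-- The function whose derivative is the difference of `variationDensity` and `covVariation`. -/
def boundaryTerm (q : (Fin n → ℝ) → Fin n → ℝ) (Γ : (Fin n → ℝ) → Fin n → Fin n → Fin n → ℝ)
    (W : A → (Fin n → ℝ) → Fin n → ℝ) (σ : A → A) (R V ξ η : ℝ → Fin n → ℝ) (x : ℝ) : ℝ :=
  ξ x ⬝ᵥ (q (R x) * covVar Γ R V η x)
    + (∑ α, pairing (W α) R V ξ x * invD (pairing (W (σ α)) R (velocity R) η) x
      - ∑ α, pairing (W α) R V η x * invD (pairing (W (σ α)) R (velocity R) ξ) x)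

end CovariantVariation

namespace HydroStructure

open Matrix

variable {n : ℕ} {A : Type*} {U : Set (Fin n → ℝ)} [Fintype A]
  {q : (Fin n → ℝ) → Fin n → ℝ} {Γ : (Fin n → ℝ) → Fin n → Fin n → Fin n → ℝ}
  {W : A → (Fin n → ℝ) → Fin n → ℝ} {σ : A → A} {R V ξ η ζ : ℝ → Fin n → ℝ}

lemma covVar_dotProduct_comm (H : HydroStructure U q Γ W σ) {x : ℝ} (hx : R x ∈ U)
    (V V' ξ : ℝ → Fin n → ℝ) : covVar Γ R V ξ x ⬝ᵥ V' x = covVar Γ R V' ξ x ⬝ᵥ V x := by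
  simp only [covVar, neg_dotProduct, ← dotProduct_mulVec, H.connMatrix_mulVec_comm hx (V x)]

section FirstVariation

variable {δ a b : ℝ} (H : HydroStructure U q Γ W σ) (hR : ContDiff ℝ ∞ R) (hV : ContDiff ℝ ∞ V)
  (hmem : ∀ ε ∈ Icc (-δ) δ, ∀ x ∈ Icc a b, R x + ε • V x ∈ U)
include H hR hV hmem

lemma isC1Family_pairing (hξ : Continuous ξ) (α : A) :
    IsC1Family δ a b
      (fun ε => pairing (W α) (fun y => R y + ε • V y) (velocity fun y => R y + ε • V y) ξ)
      (fun ε => varPairing (W α) (fun y => R y + ε • V y) V ξ) :=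
  IsC1Family.sum Finset.univ fun j => IsC1Family.const_mul
    ((continuous_apply j).comp hξ).continuousOn
    ((isC1Family_comp H.isOpen (H.contDiffOn_affinor α) hR.continuous hV.continuous hmem
      (ContinuousLinearMap.proj j)).mul (isC1Family_velocity hR hV j))

lemma isC1Family_connMatrix (j i : Fin n) :
    IsC1Family δ a b
      (fun ε x => connMatrix (Γ (R x + ε • V x)) (velocity (fun y => R y + ε • V y) x) j i)
      (fun ε x => (connMatrix (fderiv ℝ Γ (R x + ε • V x) (V x))
          (velocity (fun y => R y + ε • V y) x)
        + connMatrix (Γ (R x + ε • V x)) (velocity V x)) j i) :=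
  let component (k : Fin n) : (Fin n → Fin n → Fin n → ℝ) →L[ℝ] ℝ :=
    (ContinuousLinearMap.proj (R := ℝ) (φ := fun _ : Fin n => ℝ) i).comp
      ((ContinuousLinearMap.proj (R := ℝ) (φ := fun _ : Fin n => Fin n → ℝ) k).comp
        (ContinuousLinearMap.proj (R := ℝ) (φ := fun _ : Fin n => Fin n → Fin n → ℝ) j))
  (IsC1Family.sum Finset.univ fun k => (isC1Family_velocity hR hV k).mul
    (isC1Family_comp H.isOpen H.contDiffOn_conn hR.continuous hV.continuous hmem
      (component k))).congr_deriv fun _ _ => Finset.sum_add_distrib.trans (add_comm _ _)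

lemma isC1Family_covDerivAlong (hη : ContDiff ℝ ∞ η) (i : Fin n) :
    IsC1Family δ a b (fun ε x => covDerivAlong Γ (fun y => R y + ε • V y) η x i)
      (fun ε x => -(η x ᵥ* (connMatrix (fderiv ℝ Γ (R x + ε • V x) (V x))
          (velocity (fun y => R y + ε • V y) x)
        + connMatrix (Γ (R x + ε • V x)) (velocity V x))) i) :=
  ((IsC1Family.const ((continuous_apply i).comp (contDiff_velocity hη).continuous).continuousOn).sub
    (IsC1Family.sum Finset.univ fun j => IsC1Family.const_mul
      ((continuous_apply j).comp hη.continuous).continuousOn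
      (H.isC1Family_connMatrix hR hV hmem j i))).congr_deriv fun _ _ => zero_sub _

lemma isC1Family_localDensity (hξ : Continuous ξ) (hη : ContDiff ℝ ∞ η) :
    IsC1Family δ a b (fun ε => localDensity q Γ (fun y => R y + ε • V y) ξ η)
      (fun ε => varLocalDensity q Γ (fun y => R y + ε • V y) V ξ η) :=
  (IsC1Family.sum Finset.univ fun i => IsC1Family.const_mul
    ((continuous_apply i).comp hξ).continuousOn
    ((isC1Family_comp H.isOpen H.contDiffOn_metric hR.continuous hV.continuous hmem
      (ContinuousLinearMap.proj i)).mul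
      (H.isC1Family_covDerivAlong hR hV hmem hη i))).congr_deriv fun _ _ =>
    Finset.sum_congr rfl fun _ _ => congrArg _ <| by
      rw [mul_neg, ← sub_eq_add_neg]
      rfl

end FirstVariation

variable (H : HydroStructure U q Γ W σ) (hR : ContDiff ℝ ∞ R) (hRU : ∀ x, R x ∈ U)
include H hR hRU

lemma hasDerivAt_bracket (hV : ContDiff ℝ ∞ V) (hξ : IsTest ξ) (hη : IsTest η) :
    HasDerivAt (fun ε : ℝ => bracket (hydroOp q Γ W σ) ξ η fun x => R x + ε • V x)
      (∫ x, (varLocalDensity q Γ R V ξ η x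
        + ∑ α, (varPairing (W α) R V ξ x * invD (pairing (W (σ α)) R (velocity R) η) x
          + pairing (W α) R (velocity R) ξ x * invD (varPairing (W (σ α)) R V η) x))) 0 := by
  obtain ⟨r, ⟨hξr, hηr⟩, hr⟩ := ((eventually_eq_zero_of_notMem_Ioo hξ.2).and
    (eventually_eq_zero_of_notMem_Ioo hη.2) |>.and (Filter.eventually_ge_atTop 0)).exists
  have hrr : -r ≤ r := neg_le_self hr
  obtain ⟨δ, hδ, hmem⟩ :=
    exists_perturbation_mem H.isOpen hR.continuous hV.continuous hRU (-r) r
  have hfamily := (H.isC1Family_localDensity hR hV hmem hξ.1.continuous hη.1).add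
    (IsC1Family.sum Finset.univ fun α =>
      (H.isC1Family_pairing hR hV hmem hξ.1.continuous α).mul
        ((H.isC1Family_pairing hR hV hmem hη.1.continuous (σ α)).map_invD hδ.le hrr
          (fun _ x hx => pairing_eq_zero (hηr x hx))
          fun _ x hx => varPairing_eq_zero (hηr x hx)))
  have hderiv := hfamily.hasDerivAt_integral (mem_Ioo.2 ⟨neg_neg_of_pos hδ, hδ⟩)
    (right_mem_Icc.2 hrr)
  simp only [zero_smul, add_zero] at hderiv
  refine (hderiv.congr_deriv ?_).congr_of_eventuallyEq (.of_forall fun ε => ?_)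
  · exact (integral_eq_intervalIntegral_of_eq_zero fun x hx => by
      simp [varLocalDensity_eq_zero (hξr x hx), pairing_eq_zero (hξr x hx),
        varPairing_eq_zero (hξr x hx)]).symm
  · refine (integral_congr_ae (.of_forall (dotProduct_hydroOp ξ η))).trans
      (integral_eq_intervalIntegral_of_eq_zero fun x hx => ?_)
    simp [localDensity_eq_zero (hξr x hx), pairing_eq_zero (hξr x hx)]

lemma integrable_sum_pairing_mul_invD (hξ : IsTest ξ) (hη : IsTest η) :
    Integrable fun x => ∑ α, pairing (W α) R (velocity R) ξ x
      * invD (pairing (W (σ α)) R (velocity R) η) x :=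
  integrable_sum_mul_invD (k := fun α => pairing (W α) R (velocity R) η)
    (H.contDiff_pairing hR hRU (contDiff_velocity hR) hξ.1)
    (fun _ => hasCompactSupport_pairing hξ.2)
    (H.contDiff_pairing hR hRU (contDiff_velocity hR) hη.1)
    fun _ => hasCompactSupport_pairing hη.2

lemma integrable_localDensity (hξ : IsTest ξ) (hη : ContDiff ℝ ∞ η) :
    Integrable (localDensity q Γ R ξ η) :=
  (H.contDiff_localDensity hR hRU hξ.1 hη).continuous.integrable_of_hasCompactSupport <|
    hasCompactSupport_of_eq_zero hξ.2 fun _ => localDensity_eq_zero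

lemma contDiff_sum_varPairing_mul_invD (hV : ContDiff ℝ ∞ V) (hξ : ContDiff ℝ ∞ ξ)
    (hη : IsTest η) :
    ContDiff ℝ ∞ fun x => ∑ α, varPairing (W α) R V ξ x
      * invD (pairing (W (σ α)) R (velocity R) η) x :=
  contDiff_sum_mul_invD (k := fun α => pairing (W α) R (velocity R) η)
    (H.contDiff_varPairing hR hRU hV hξ)
    (H.contDiff_pairing hR hRU (contDiff_velocity hR) hη.1)
    fun _ => hasCompactSupport_pairing hη.2

lemma contDiff_variationDensity (hV : ContDiff ℝ ∞ V) (hξ : IsTest ξ) (hη : IsTest η) :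
    ContDiff ℝ ∞ (variationDensity q Γ W σ R V ξ η) :=
  ((H.contDiff_varLocalDensity hR hRU hV hξ.1 hη.1).add
    (H.contDiff_sum_varPairing_mul_invD hR hRU hV hξ.1 hη)).sub
      (H.contDiff_sum_varPairing_mul_invD hR hRU hV hη.1 hξ)

lemma integral_eq_integral_variationDensity (hV : ContDiff ℝ ∞ V) (hξ : IsTest ξ)
    (hη : IsTest η) :
    ∫ x, (varLocalDensity q Γ R V ξ η x
        + ∑ α, (varPairing (W α) R V ξ x * invD (pairing (W (σ α)) R (velocity R) η) x
          + pairing (W α) R (velocity R) ξ x * invD (varPairing (W (σ α)) R V η) x))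
      = ∫ x, variationDensity q Γ W σ R V ξ η x := by
  have hp {ζ} (hζ : IsTest ζ) := H.contDiff_pairing hR hRU (contDiff_velocity hR) hζ.1
  have hps {ζ} (hζ : IsTest ζ) (α : A) : HasCompactSupport (pairing (W α) R (velocity R) ζ) :=
    hasCompactSupport_pairing hζ.2
  have hv {ζ} (hζ : IsTest ζ) := H.contDiff_varPairing hR hRU hV hζ.1
  have hvs {ζ} (hζ : IsTest ζ) (α : A) : HasCompactSupport (varPairing (W α) R V ζ) :=
    hasCompactSupport_varPairing hζ.2
  have hlocal : Integrable (varLocalDensity q Γ R V ξ η) :=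
    (H.contDiff_varLocalDensity hR hRU hV hξ.1 hη.1).continuous.integrable_of_hasCompactSupport <|
      hasCompactSupport_of_eq_zero hξ.2 fun _ => varLocalDensity_eq_zero
  have hsum := integrable_sum_mul_invD (σ := σ) (hv hξ) (hvs hξ) (hp hη) (hps hη)
  have hsum' := integrable_sum_mul_invD (σ := σ) (hv hη) (hvs hη) (hp hξ) (hps hξ)
  have hsum'' := integrable_sum_mul_invD (σ := σ) (hp hξ) (hps hξ) (hv hη) (hvs hη)
  simp only [Finset.sum_add_distrib, variationDensity, ← add_assoc]
  refine (integral_add (hlocal.add hsum) hsum'').trans ?_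
  rw [integral_sum_mul_invD H.involutive (hp hξ) (hps hξ) (hv hη) (hvs hη), ← sub_eq_add_neg]
  exact (integral_sub (hlocal.add hsum) hsum').symm

lemma hasDerivAt_sum_pairing_mul_invD (hV : ContDiff ℝ ∞ V) (hξ : IsTest ξ) (hη : IsTest η)
    (x : ℝ) :
    HasDerivAt
      (fun y => ∑ α, pairing (W α) R V ξ y * invD (pairing (W (σ α)) R (velocity R) η) y)
      (∑ α, varPairing (W α) R V ξ x * invD (pairing (W (σ α)) R (velocity R) η) x
        - ∑ α, pairing (W α) R (velocity R) (covVar Γ R V ξ) x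
          * invD (pairing (W (σ α)) R (velocity R) η) x
        + covDerivAlong Γ R ξ x ⬝ᵥ (V x * tail W σ R η x)
        + ∑ α, pairing (W α) R V ξ x * pairing (W (σ α)) R (velocity R) η x) x := by
  have hinvD (α : A) := hasDerivAt_invD
    (H.contDiff_pairing hR hRU (contDiff_velocity hR) hη.1 α).continuous
    (hasCompactSupport_pairing hη.2) x
  refine (HasDerivAt.fun_sum fun α _ =>
    (H.hasDerivAt_pairing hR hRU hV hξ.1 α x).fun_mul (hinvD (σ α))).congr_deriv ?_
  rw [dotProduct_mul_tail]
  simp only [← Finset.sum_sub_distrib, ← Finset.sum_add_distrib, ← sub_mul, ← add_mul]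
  rfl

lemma hasDerivAt_boundaryTerm (hV : ContDiff ℝ ∞ V) (hξ : IsTest ξ) (hη : IsTest η) (x : ℝ) :
    HasDerivAt (boundaryTerm q Γ W σ R V ξ η)
      (variationDensity q Γ W σ R V ξ η x - covVariation q Γ W σ R V ξ η x) x := by
  refine ((H.hasDerivAt_dotProduct_metric_mul hR hRU hξ.1
      (H.contDiff_covVar hR hRU hV hη.1) x).add
    ((H.hasDerivAt_sum_pairing_mul_invD hR hRU hV hξ hη x).sub
      (H.hasDerivAt_sum_pairing_mul_invD hR hRU hV hη hξ x))).congr_deriv ?_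
  rw [H.localDensity_covVar hR hRU hV hη.1, Finset.sum_sub_distrib, variationDensity,
    covVariation, dotProduct_hydroOp, dotProduct_hydroOp]
  ring

lemma contDiff_covVariation (hV : ContDiff ℝ ∞ V) (hξ : IsTest ξ) (hη : IsTest η) :
    ContDiff ℝ ∞ (covVariation q Γ W σ R V ξ η) :=
  ((contDiff_dotProduct (H.contDiff_covVar hR hRU hV hξ.1) (H.contDiff_hydroOp hR hRU hη)).sub
    (contDiff_dotProduct (H.contDiff_covVar hR hRU hV hη.1) (H.contDiff_hydroOp hR hRU hξ))).add
  ((contDiff_dotProduct (H.contDiff_covDerivAlong hR hRU hη.1)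
      (hV.mul (H.contDiff_tail hR hRU hξ))).sub
    (contDiff_dotProduct (H.contDiff_covDerivAlong hR hRU hξ.1)
      (hV.mul (H.contDiff_tail hR hRU hη))))

lemma integrable_variationDensity (hV : ContDiff ℝ ∞ V) (hξ : IsTest ξ) (hη : IsTest η) :
    Integrable (variationDensity q Γ W σ R V ξ η) :=
  (H.contDiff_variationDensity hR hRU hV hξ hη).continuous.integrable_of_hasCompactSupport
    (((hasCompactSupport_of_eq_zero hξ.2 fun _ => varLocalDensity_eq_zero).add
      (hasCompactSupport_sum_mul (fun _ => hasCompactSupport_varPairing hξ.2) _)).sub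
        (hasCompactSupport_sum_mul (fun _ => hasCompactSupport_varPairing hη.2) _))

lemma integrable_covVariation (hV : ContDiff ℝ ∞ V) (hξ : IsTest ξ) (hη : IsTest η) :
    Integrable (covVariation q Γ W σ R V ξ η) := by
  have hcovVar {ζ} (hζ : IsTest ζ) : HasCompactSupport (covVar Γ R V ζ) :=
    hasCompactSupport_of_eq_zero hζ.2 fun x hx => by simp [covVar, hx]
  have hcovDeriv {ζ} (hζ : IsTest ζ) : HasCompactSupport (covDerivAlong Γ R ζ) :=
    (hasCompactSupport_velocity hζ).sub (hasCompactSupport_of_eq_zero hζ.2 fun x hx => by simp [hx])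
  have hdot {φ} (hφ : HasCompactSupport φ) (ψ : ℝ → Fin n → ℝ) :
      HasCompactSupport fun x => φ x ⬝ᵥ ψ x :=
    hasCompactSupport_of_eq_zero hφ fun x hx => by simp [hx]
  exact (H.contDiff_covVariation hR hRU hV hξ hη).continuous.integrable_of_hasCompactSupport
    (((hdot (hcovVar hξ) _).sub (hdot (hcovVar hη) _)).add
      ((hdot (hcovDeriv hη) _).sub (hdot (hcovDeriv hξ) _)))

lemma integral_variationDensity (hV : ContDiff ℝ ∞ V) (hξ : IsTest ξ) (hη : IsTest η) :
    ∫ x, variationDensity q Γ W σ R V ξ η x = ∫ x, covVariation q Γ W σ R V ξ η x := by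
  have hsupp : HasCompactSupport (boundaryTerm q Γ W σ R V ξ η) :=
    (hasCompactSupport_of_eq_zero hξ.2 fun x hx => by simp [hx]).add
      ((hasCompactSupport_sum_mul (fun _ => hasCompactSupport_pairing hξ.2) _).sub
        (hasCompactSupport_sum_mul (fun _ => hasCompactSupport_pairing hη.2) _))
  have hzero := integral_deriv_eq_zero_of_hasCompactSupport
    (H.hasDerivAt_boundaryTerm hR hRU hV hξ hη)
    ((H.contDiff_variationDensity hR hRU hV hξ hη).continuous.sub
      (H.contDiff_covVariation hR hRU hV hξ hη).continuous) hsupp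
  rwa [integral_sub (H.integrable_variationDensity hR hRU hV hξ hη)
    (H.integrable_covVariation hR hRU hV hξ hη), sub_eq_zero] at hzero

lemma hasDerivAt_bracket_covVariation (hV : ContDiff ℝ ∞ V) (hξ : IsTest ξ) (hη : IsTest η) :
    HasDerivAt (fun ε : ℝ => bracket (hydroOp q Γ W σ) ξ η fun x => R x + ε • V x)
      (∫ x, covVariation q Γ W σ R V ξ η x) 0 :=
  (H.hasDerivAt_bracket hR hRU hV hξ hη).congr_deriv <|
    (H.integral_eq_integral_variationDensity hR hRU hV hξ hη).trans
      (H.integral_variationDensity hR hRU hV hξ hη)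

lemma integrable_dotProduct_hydroOp (hξ : IsTest ξ) (hη : IsTest η) :
    Integrable fun x => ξ x ⬝ᵥ hydroOp q Γ W σ R η x :=
  (contDiff_dotProduct hξ.1
    (H.contDiff_hydroOp hR hRU hη)).continuous.integrable_of_hasCompactSupport <|
      hasCompactSupport_of_eq_zero hξ.2 fun x hx => by simp [hx]

lemma integral_localDensity_add (hξ : IsTest ξ) (hη : IsTest η) :
    (∫ x, localDensity q Γ R ξ η x) + ∫ x, localDensity q Γ R η ξ x = 0 := by
  rw [← integral_add (H.integrable_localDensity hR hRU hξ hη.1)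
    (H.integrable_localDensity hR hRU hη hξ.1)]
  exact integral_deriv_eq_zero_of_hasCompactSupport
    (H.hasDerivAt_dotProduct_metric_mul hR hRU hξ.1 hη.1)
    ((H.contDiff_localDensity hR hRU hξ.1 hη.1).continuous.add
      (H.contDiff_localDensity hR hRU hη.1 hξ.1).continuous)
    (hasCompactSupport_of_eq_zero hξ.2 fun x hx => by simp [hx])

lemma bracket_eq_integral_add (hξ : IsTest ξ) (hη : IsTest η) :
    bracket (hydroOp q Γ W σ) ξ η R = (∫ x, localDensity q Γ R ξ η x)
      + ∫ x, ∑ α, pairing (W α) R (velocity R) ξ x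
        * invD (pairing (W (σ α)) R (velocity R) η) x :=
  (integral_congr_ae (.of_forall (dotProduct_hydroOp ξ η))).trans <|
    integral_add (H.integrable_localDensity hR hRU hξ hη.1)
      (H.integrable_sum_pairing_mul_invD hR hRU hξ hη)

lemma bracket_skew (hξ : IsTest ξ) (hη : IsTest η) :
    bracket (hydroOp q Γ W σ) ξ η R = -bracket (hydroOp q Γ W σ) η ξ R := by
  have htail := integral_sum_mul_invD H.involutive
    (H.contDiff_pairing hR hRU (contDiff_velocity hR) hξ.1)
    (fun _ => hasCompactSupport_pairing hξ.2)
    (H.contDiff_pairing hR hRU (contDiff_velocity hR) hη.1)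
    fun _ => hasCompactSupport_pairing hη.2
  rw [H.bracket_eq_integral_add hR hRU hξ hη, H.bracket_eq_integral_add hR hRU hη hξ, htail,
    eq_neg_of_add_eq_zero_left (H.integral_localDensity_add hR hRU hξ hη), neg_add]

omit hR in
lemma covVariation_cyclic (ξ η ζ : ℝ → Fin n → ℝ) (x : ℝ) :
    covVariation q Γ W σ R (hydroOp q Γ W σ R ζ) ξ η x
      + covVariation q Γ W σ R (hydroOp q Γ W σ R ξ) η ζ x
      + covVariation q Γ W σ R (hydroOp q Γ W σ R η) ζ ξ x = 0 := by
  have htail : ∀ ξ η ζ : ℝ → Fin n → ℝ,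
      covDerivAlong Γ R η x ⬝ᵥ (hydroOp q Γ W σ R ζ x * tail W σ R ξ x)
        = ∑ i, (covDerivAlong Γ R η x i * q (R x) i * covDerivAlong Γ R ζ x i * tail W σ R ξ x i
          + covDerivAlong Γ R η x i * velocity R x i * tail W σ R ζ x i * tail W σ R ξ x i) :=
    fun ξ η ζ => Finset.sum_congr rfl fun i _ => by
      simp only [hydroOp, Pi.mul_apply, Pi.add_apply]
      ring
  have hcancel : covDerivAlong Γ R η x ⬝ᵥ (hydroOp q Γ W σ R ζ x * tail W σ R ξ x)
      - covDerivAlong Γ R ξ x ⬝ᵥ (hydroOp q Γ W σ R ζ x * tail W σ R η x)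
      + (covDerivAlong Γ R ζ x ⬝ᵥ (hydroOp q Γ W σ R ξ x * tail W σ R η x)
      - covDerivAlong Γ R η x ⬝ᵥ (hydroOp q Γ W σ R ξ x * tail W σ R ζ x))
      + (covDerivAlong Γ R ξ x ⬝ᵥ (hydroOp q Γ W σ R η x * tail W σ R ζ x)
      - covDerivAlong Γ R ζ x ⬝ᵥ (hydroOp q Γ W σ R η x * tail W σ R ξ x)) = 0 := by
    simp only [htail, ← Finset.sum_sub_distrib, ← Finset.sum_add_distrib]
    exact Finset.sum_eq_zero fun i _ => by ring
  simp only [covVariation]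
  linear_combination hcancel
    + H.covVar_dotProduct_comm (hRU x) (hydroOp q Γ W σ R ζ) (hydroOp q Γ W σ R η) ξ
    + H.covVar_dotProduct_comm (hRU x) (hydroOp q Γ W σ R ξ) (hydroOp q Γ W σ R ζ) η
    + H.covVar_dotProduct_comm (hRU x) (hydroOp q Γ W σ R η) (hydroOp q Γ W σ R ξ) ζ

lemma jacobi (hξ : IsTest ξ) (hη : IsTest η) (hζ : IsTest ζ) :
    doubleBracket (hydroOp q Γ W σ) ξ η ζ R + doubleBracket (hydroOp q Γ W σ) η ζ ξ R
      + doubleBracket (hydroOp q Γ W σ) ζ ξ η R = 0 := by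
  have hJ {θ} (hθ : IsTest θ) := H.contDiff_hydroOp hR hRU hθ
  have hint {ξ η ζ} (hξ : IsTest ξ) (hη : IsTest η) (hζ : IsTest ζ) :=
    H.integrable_covVariation hR hRU (hJ hζ) hξ hη
  simp only [doubleBracket, (H.hasDerivAt_bracket_covVariation hR hRU (hJ hζ) hξ hη).deriv,
    (H.hasDerivAt_bracket_covVariation hR hRU (hJ hξ) hη hζ).deriv,
    (H.hasDerivAt_bracket_covVariation hR hRU (hJ hη) hζ hξ).deriv]
  rw [← integral_add (hint hξ hη hζ) (hint hη hζ hξ)]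
  refine (integral_add ((hint hξ hη hζ).add (hint hη hζ hξ)) (hint hζ hξ hη)).symm.trans ?_
  exact integral_eq_zero_of_ae (.of_forall (H.covVariation_cyclic hRU ξ η ζ))

omit hR hRU in
theorem isHamiltonian : IsHamiltonian U (hydroOp q Γ W σ) where
  integrable _ hR hRU _ _ hξ hη := H.integrable_dotProduct_hydroOp hR hRU hξ hη
  skew _ hR hRU _ _ hξ hη := H.bracket_skew hR hRU hξ hη
  differentiable _ hR hRU _ _ _ hξ hη hζ := (H.hasDerivAt_bracket_covVariation hR hRU
    (H.contDiff_hydroOp hR hRU hζ) hξ hη).differentiableAt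
  jacobi _ hR hRU _ _ _ hξ hη hζ := H.jacobi hR hRU hξ hη hζ

end HydroStructure

section DiagonalNonlocal

open Matrix

variable {n N : ℕ} {U : Set (Fin n → ℝ)} {g : Fin n → (Fin n → ℝ) → ℝ}
  {p r : Fin N → Fin n → (Fin n → ℝ) → ℝ} {R : Fin n → ℝ}

/-- The diagonal entries `1 / g i` of the contravariant metric. -/
def contravariantMetric (g : Fin n → (Fin n → ℝ) → ℝ) (R : Fin n → ℝ) (i : Fin n) : ℝ :=
  (diagMetric g R)⁻¹ i i

/-- The Levi-Civita connection of a diagonal metric, with the point as first argument. -/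
def leviCivita (g : Fin n → (Fin n → ℝ) → ℝ) (R : Fin n → ℝ) (i j k : Fin n) : ℝ :=
  christoffel (diagMetric g) i j k R

/-- The affinors of the `2 N` tails, the two families being exchanged by `Sum.swap`. -/
def tailAffinor (p r : Fin N → Fin n → (Fin n → ℝ) → ℝ) (α : Fin N ⊕ Fin N) (R : Fin n → ℝ)
    (i : Fin n) : ℝ :=
  Sum.elim p r α i R

lemma sum_inv_diagMetric_mul (R φ : Fin n → ℝ) (i : Fin n) :
    ∑ j, (diagMetric g R)⁻¹ i j * φ j = contravariantMetric g R i * φ i :=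
  Finset.sum_eq_single i (fun j _ hj => by rw [inv_diagMetric_of_ne hj.symm, zero_mul])
    fun hi => absurd (Finset.mem_univ i) hi

lemma sum_inv_diagMetric_mul_christoffel (R u ξ : Fin n → ℝ) (i : Fin n) :
    ∑ j, ∑ s, ∑ k, (diagMetric g R)⁻¹ i s * christoffel (diagMetric g) j s k R * u k * ξ j
      = contravariantMetric g R i * (ξ ᵥ* connMatrix (leviCivita g R) u) i := by
  simp only [vecMul, dotProduct, connMatrix, of_apply, leviCivita, Finset.mul_sum]
  refine Finset.sum_congr rfl fun j _ => ?_
  rw [Finset.sum_comm]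
  refine Finset.sum_congr rfl fun k _ => ?_
  have h := sum_inv_diagMetric_mul (g := g) R
    (fun s => christoffel (diagMetric g) j s k R * u k * ξ j) i
  simp only [← mul_assoc] at h
  rw [h, christoffel_comm (isSymm_diagMetric g) j i k]
  ring

lemma sum_affinor_mul_deriv_eq_pairing (y : Fin n → (Fin n → ℝ) → ℝ) (R ξ : ℝ → Fin n → ℝ) :
    (fun z => ∑ j, y j (R z) * deriv (fun t => R t j) z * ξ z j)
      = pairing (fun S i => y i S) R (velocity R) ξ := by
  funext z
  exact Finset.sum_congr rfl fun j _ => mul_comm _ _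

lemma nonlocalOp_eq_hydroOp (g : Fin n → (Fin n → ℝ) → ℝ)
    (p r : Fin N → Fin n → (Fin n → ℝ) → ℝ) :
    nonlocalOp (diagMetric g) p r
      = hydroOp (contravariantMetric g) (leviCivita g) (tailAffinor p r) Sum.swap := by
  funext R ξ x i
  have htail (y z : Fin N → Fin n → (Fin n → ℝ) → ℝ) :
      ∑ β, y β i (R x) * deriv (fun t => R t i) x
          * invD (pairing (fun S j => z β j S) R (velocity R) ξ) x
        = velocity R x i
          * ∑ β, invD (pairing (fun S j => z β j S) R (velocity R) ξ) x * y β i (R x) := by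
    rw [Finset.mul_sum]
    exact Finset.sum_congr rfl fun β _ => by rw [velocity]; ring
  simp only [nonlocalOp, sum_affinor_mul_deriv_eq_pairing, htail, sum_inv_diagMetric_mul]
  rw [sum_inv_diagMetric_mul_christoffel (R x) (fun k => deriv (fun y => R y k) x)]
  simp only [hydroOp, covDerivAlong, tail, Fintype.sum_sum_type, Sum.swap_inl, Sum.swap_inr,
    Pi.add_apply, Pi.mul_apply, Pi.sub_apply, Finset.sum_apply, Pi.smul_apply, smul_eq_mul]
  rw [mul_sub, mul_add, add_assoc]
  rfl

lemma contravariantMetric_eq_inv (h0 : ∀ i, g i R ≠ 0) (i : Fin n) :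
    contravariantMetric g R i = (g i R)⁻¹ := by
  rw [contravariantMetric, inv_diagMetric h0, if_pos rfl]

lemma contDiffOn_contravariantMetric (hg : ∀ i, ContDiffOn ℝ ∞ (g i) U)
    (hg0 : ∀ i, ∀ R ∈ U, g i R ≠ 0) : ContDiffOn ℝ ∞ (contravariantMetric g) U :=
  contDiffOn_pi.2 fun i => ((hg i).inv (hg0 i)).congr fun R hR =>
    contravariantMetric_eq_inv (fun i => hg0 i R hR) i

lemma pd_contravariantMetric (hU : IsOpen U) (hg : ∀ i, ContDiffOn ℝ ∞ (g i) U)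
    (hg0 : ∀ i, ∀ R ∈ U, g i R ≠ 0) (hR : R ∈ U) (i k : Fin n) :
    pd k (fun S => contravariantMetric g S i) R = -(2 * (g i R)⁻¹ * pdLogLame g i k R) := by
  have h0 := hg0 i R hR
  rw [pd_congr hU (fun S hS => contravariantMetric_eq_inv (fun i => hg0 i S hS) i) hR,
    pd_inv (differentiableAt_of_mem hU (hg i) hR) h0, pd_eq_mul_pdLogLame h0]
  field_simp

lemma hydroStructure_of_isCodazzi (hU : IsOpen U) (hg : ∀ i, ContDiffOn ℝ ∞ (g i) U)
    (hg0 : ∀ i, ∀ R ∈ U, g i R ≠ 0) (hp : ∀ β i, ContDiffOn ℝ ∞ (p β i) U)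
    (hr : ∀ β i, ContDiffOn ℝ ∞ (r β i) U) (hpcod : ∀ β, ∀ R ∈ U, IsCodazzi g (p β) R)
    (hrcod : ∀ β, ∀ R ∈ U, IsCodazzi g (r β) R)
    (hcurv : ∀ R ∈ U, ∀ i j k l, curvature (diagMetric g) i j k l R
      = (∑ β, (p β i R * r β j R + p β j R * r β i R))
        * ((if i = k then 1 else 0) * (if j = l then 1 else 0)
          - (if i = l then 1 else 0) * (if j = k then 1 else 0))) :
    HydroStructure U (contravariantMetric g) (leviCivita g) (tailAffinor p r) Sum.swap where
  isOpen := hU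
  involutive := Sum.swap_swap
  contDiffOn_metric := contDiffOn_contravariantMetric hg hg0
  contDiffOn_conn := contDiffOn_pi.2 fun i => contDiffOn_pi.2 fun j => contDiffOn_pi.2 fun k =>
    contDiffOn_christoffel hU hg hg0 i j k
  contDiffOn_affinor
    | .inl β => contDiffOn_pi.2 (hp β)
    | .inr β => contDiffOn_pi.2 (hr β)
  symm R _ i j k := christoffel_comm (isSymm_diagMetric g) i j k R
  metric R hR i j k := by
    have h0 i := hg0 i R hR
    rw [add_assoc, pd_contravariantMetric hU hg hg0 hR, contravariantMetric_eq_inv h0,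
      contravariantMetric_eq_inv h0, leviCivita, leviCivita, christoffel_diag_metric h0]
    split_ifs <;> ring
  codazzi
    | .inl β, R, hR => (hpcod β R hR).pd_add_christoffel_mul fun i => hg0 i R hR
    | .inr β, R, hR => (hrcod β R hR).pd_add_christoffel_mul fun i => hg0 i R hR
  gauss R hR i j k l := by
    have h0 i := hg0 i R hR
    have h := hcurv R hR i j k l
    rw [curvature_diag h0, riemann_eq_connCurv] at h
    rw [contravariantMetric_eq_inv h0, Fintype.sum_sum_type]
    simp only [Finset.sum_add_distrib, mul_comm (p _ j R)] at h
    exact h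

theorem isHamiltonian_nonlocalOp (hU : IsOpen U) (hg : ∀ i, ContDiffOn ℝ ∞ (g i) U)
    (hg0 : ∀ i, ∀ R ∈ U, g i R ≠ 0) (hp : ∀ β i, ContDiffOn ℝ ∞ (p β i) U)
    (hr : ∀ β i, ContDiffOn ℝ ∞ (r β i) U) (hpcod : ∀ β, ∀ R ∈ U, IsCodazzi g (p β) R)
    (hrcod : ∀ β, ∀ R ∈ U, IsCodazzi g (r β) R)
    (hcurv : ∀ R ∈ U, ∀ i j k l, curvature (diagMetric g) i j k l R
      = (∑ β, (p β i R * r β j R + p β j R * r β i R))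
        * ((if i = k then 1 else 0) * (if j = l then 1 else 0)
          - (if i = l then 1 else 0) * (if j = k then 1 else 0))) :
    IsHamiltonian U (nonlocalOp (diagMetric g) p r) := by
  rw [nonlocalOp_eq_hydroOp]
  exact (hydroStructure_of_isCodazzi hU hg hg0 hp hr hpcod hrcod hcurv).isHamiltonian

end DiagonalNonlocal

section ReciprocalTransformation

variable {n N : ℕ} {U : Set (Fin n → ℝ)} {g : Fin n → (Fin n → ℝ) → ℝ}
  {v : Fin N → Fin n → (Fin n → ℝ) → ℝ}

lemma mixedHess_eq_zero_of_forall_conserved (hU : IsOpen U)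
    (hv : ∀ β i, ContDiffOn ℝ ∞ (v β i) U) {f : (Fin n → ℝ) → ℝ} (hf : ContDiffOn ℝ ∞ f U)
    {b : Fin N → (Fin n → ℝ) → ℝ} (hb : ∀ β, ContDiffOn ℝ ∞ (b β) U)
    (hfb : ∀ β, ∀ R ∈ U, ∀ i, pd i (b β) R = v β i R * pd i f R) {R : Fin n → ℝ} (hR : R ∈ U)
    (h0 : ∀ i, g i R ≠ 0) (hcod : ∀ β, IsCodazzi g (v β) R) {i j : Fin n} (hij : i ≠ j)
    (hdiag : (∀ β, v β i R = v β j R) → mixedHess (diagMetric g) f i j R = 0) :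
    mixedHess (diagMetric g) f i j R = 0 := by
  by_cases hvij : ∀ β, v β i R = v β j R
  · exact hdiag hvij
  · obtain ⟨β, hβ⟩ := not_forall.1 hvij
    exact mixedHess_eq_zero_of_conserved hU (hv β) hf (hb β) (hfb β) hR h0 (hcod β) hij hβ

lemma ReciprocalSetup.isHamiltonian_nonlocalOp [NeZero N]
    {a c : Fin N → Fin N → (Fin n → ℝ) → ℝ} (H : ReciprocalSetup U g v a c) :
    IsHamiltonian U
      (nonlocalOp (diagMetric (newMetric g a v)) (newSpeed a v) (newExtraSpeed g a c v)) :=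
  RecipTransf.isHamiltonian_nonlocalOp H.isOpen H.contDiffOn_newMetric H.newMetric_ne_zero
    H.contDiffOn_newSpeed H.contDiffOn_newExtraSpeed (fun β _ hR => H.isCodazzi_newSpeed hR β)
    (fun β _ hR => H.isCodazzi_newExtraSpeed hR β) fun _ hR => H.curvature_newMetric hR

end ReciprocalTransformation

end RecipTransf

end

theorem theorem4 {n N : ℕ} [NeZero N] (U : Set (Fin n → ℝ)) (hU : IsOpen U)
    -- the flat diagonal metric
    (g : Fin n → (Fin n → ℝ) → ℝ) (hg : ∀ i, ContDiffOn ℝ ∞ (g i) U)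
    (hg0 : ∀ i, ∀ R ∈ U, g i R ≠ 0)
    (hflat : ∀ R ∈ U, ∀ i j k l, RecipTransf.curvature (RecipTransf.diagMetric g) i j k l R = 0)
    -- the diagonal flows with speeds `v`, generated by the densities `h`
    (h : Fin N → (Fin n → ℝ) → ℝ) (hh : ∀ β, ContDiffOn ℝ ∞ (h β) U)
    (v : Fin N → Fin n → (Fin n → ℝ) → ℝ)
    (hv : ∀ β, ∀ R ∈ U, ∀ i j,
      RecipTransf.mixedHess (RecipTransf.diagMetric g) (h β) i j R = if i = j then v β i R else 0)
    (hv1 : ∀ i, ∀ R ∈ U, v 0 i R = 1)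
    -- `a γ 0` are conserved densities of the flows, with fluxes `a γ β`
    (a : Fin N → Fin N → (Fin n → ℝ) → ℝ) (ha : ∀ γ β, ContDiffOn ℝ ∞ (a γ β) U)
    (hcons : ∀ γ β, ∀ R ∈ U, ∀ i,
      RecipTransf.pd i (a γ β) R = v β i R * RecipTransf.pd i (a γ 0) R)
    (hdet : ∀ R ∈ U, IsUnit (Matrix.of fun γ β => a γ β R).det)
    (hnz : ∀ R ∈ U, ∀ i, RecipTransf.speedSum a v 0 i R ≠ 0)
    -- the flows generated by `a γ 0` are diagonal; this has to be required only where all the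
    -- speeds in two directions coincide
    (hdiag : ∀ R ∈ U, ∀ i j, i ≠ j → (∀ β, v β i R = v β j R) →
      ∀ γ, RecipTransf.mixedHess (RecipTransf.diagMetric g) (a γ 0) i j R = 0)
    -- `c γ β` is the flux of the density `a γ 0` along the flow generated by `a β 0`
    (c : Fin N → Fin N → (Fin n → ℝ) → ℝ) (hc : ∀ γ β, ContDiffOn ℝ ∞ (c γ β) U)
    (hflux : ∀ γ β, ∀ R ∈ U, ∀ i,
      RecipTransf.pd i (c γ β) R = RecipTransf.extraSpeed g a β i R * RecipTransf.pd i (a γ 0) R)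
    (hnorm : ∀ γ β, ∀ R ∈ U,
      c γ β R + c β γ R
        = ∑ k, (g k R)⁻¹ * RecipTransf.pd k (a β 0) R * RecipTransf.pd k (a γ 0) R) :
    (∀ R ∈ U, ∀ i j k l,
      RecipTransf.curvature (RecipTransf.diagMetric (RecipTransf.newMetric g a v)) i j k l R
        = (∑ β, (RecipTransf.newSpeed a v β i R * RecipTransf.newExtraSpeed g a c v β j R
            + RecipTransf.newSpeed a v β j R * RecipTransf.newExtraSpeed g a c v β i R))
          * ((if i = k then 1 else 0) * (if j = l then 1 else 0)
            - (if i = l then 1 else 0) * (if j = k then 1 else 0)))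
    ∧ RecipTransf.IsHamiltonian U
        (RecipTransf.nonlocalOp (RecipTransf.diagMetric (RecipTransf.newMetric g a v))
          (RecipTransf.newSpeed a v) (RecipTransf.newExtraSpeed g a c v)) := by
  have hsmooth (β : Fin N) (i : Fin n) : ContDiffOn ℝ ∞ (v β i) U :=
    (RecipTransf.contDiffOn_mixedHess hU hg hg0 (hh β) i i).congr fun R hR => by
      rw [hv β R hR, if_pos rfl]
  have hcod (β : Fin N) (R : Fin n → ℝ) (hR : R ∈ U) : RecipTransf.IsCodazzi g (v β) R :=
    RecipTransf.isCodazzi_of_mixedHess hU hg hg0 hflat (hh β) (hsmooth β) (hv β) hR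
  have hdensity (γ : Fin N) (R : Fin n → ℝ) (hR : R ∈ U) (i j : Fin n) :
      RecipTransf.mixedHess (RecipTransf.diagMetric g) (a γ 0) i j R
        = if i = j then RecipTransf.extraSpeed g a γ i R else 0 := by
    split_ifs with hij
    · rw [← hij, RecipTransf.extraSpeed]
    · exact RecipTransf.mixedHess_eq_zero_of_forall_conserved hU hsmooth (ha γ 0) (ha γ) (hcons γ)
        hR (fun i => hg0 i R hR) (fun β => hcod β R hR) hij fun h => hdiag R hR i j hij h γ
  have H : RecipTransf.ReciprocalSetup U g v a c :=
    ⟨hU, hg, hg0, hflat, hsmooth, hcod, ha, hcons, hdet, fun i R hR => hnz R hR i, hdensity,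
      hc, hflux, hnorm⟩
  exact ⟨fun _ hR => H.curvature_newMetric hR, H.isHamiltonian_nonlocalOp⟩
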